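/- Let $T$ be a text over a linearly ordered alphabet $\Sigma$ of finite size $\sigma\ge 2$ whose last character occurs nowhere else in $T$. A substring $w$ of $T$ that occurs at least twice is a maximal repeat if every $wa$ and every $aw$ ($a\in\Sigma$) occurs strictly fewer times in $T$ than $w$ (the empty string is counted as occurring $|T|+1$ times); $\tilde e_T$ is the number of substrings of $T$ of the form $wa$ plus the number of those of the form $aw$, with $w$ a maximal repeat and $a\in\Sigma$. Let $\mathrm{L\text{-}CDAWG}(T)$ be the compact directed acyclic word graph of $T$ (the nodes of which are called type-1) with an additional non-branching type-2 node at the end of the path spelling $au$ whenever $u$ is the longest string represented by a type-1 node, $a\in\Sigma$, $au$ is a substring of $T$, and that path ends in the middle of an edge. The suffix link of this type-2 node is the node of $u$; the suffix link of a type-1 node with longest string $v$ is the node of the longest suffix of $v$ that the node does not represent. Write $e.hi$ for the upper end and $\mathrm{lab}(e)$ for the label string of an edge $e$. For an edge $e$ with $|\mathrm{lab}(e)|\ge 2$ let $\mathrm{esuf}(e)=(e_1,\dots,e_k)$ be the path that starts at the suffix link of $e.hi$ and spells $\mathrm{lab}(e)$, and define recursively $\mathrm{jump}(e)=\mathrm{jump}(e_1)$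 if $k=1$ and $\mathrm{jump}(e)=(e_1,\dots,e_k)$ if $k\ge2$. (1) For every edge $e$ of $\mathrm{L\text{-}CDAWG}(T)$ with $|\mathrm{lab}(e)|\ge2$, $\mathrm{jump}(e)$ is well defined, and it is a path of at least two edges that spells $\mathrm{lab}(e)$. (2) There is an algorithm, a fixed program of a word RAM with words of $w$ bits, $2^w\ge C(|T|+\tilde e_T)$, that accesses characters only by comparing the first characters of two edges, with the following property. Suppose $\mathrm{L\text{-}CDAWG}(T)$ is given in memory without the text and the label strings: for each node its type, its suffix link and the list of its outgoing edges sorted by first character; for each edge its two end points, its first character (accessible through comparisons only) and its label length. Then the algorithm computes all jump links in at most $C\,\tilde e_T\log_2\sigma$ steps, keeping the given structure intact. That is, afterwards memory holds for every edge $e$ with $|\mathrm{lab}(e)|\ge2$ a pointer to a linked list of the edges of $\mathrm{jump}(e)$ in order, where lists may share cells. The constant $C$ and the program do not depend on $T$, $\Sigma$, $\sigma$ or $w$. -/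

import Mathlib

namespace LCDAWG

universe u

variable {α : Type u}

/-! ### Occurrences, maximal repeats and their extensions

Strings over `α` are lists. The empty string occurs at all `|T| + 1` positions of `T`. -/

/-- The beginning positions of the occurrences of `x` in `T`. -/
def begPos (T x : List α) : Set ℕ := {i | i ≤ T.length ∧ x <+: T.drop i}

/-- The ending positions of the occurrences of `x` in `T`. -/
def endPos (T x : List α) : Set ℕ := {j | j ≤ T.length ∧ x <:+ T.take j}

/-- The number of occurrences of `x` in `T`. -/
noncomputable def occ (T x : List α) : ℕ := (begPos T x).ncard

/-- A maximal repeat of `T`: a repeat all of whose left and right extensions occur strictly fewer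
times. -/
def IsMaximalRepeat (T w : List α) : Prop :=
  1 < occ T w ∧
    (∀ a : α, w ++ [a] <:+: T → occ T (w ++ [a]) < occ T w) ∧
    (∀ a : α, a :: w <:+: T → occ T (a :: w) < occ T w)

/-- The right extensions of maximal repeats that appear in `T`. -/
def rightExtensions (T : List α) : Set (List α) :=
  {y | ∃ (w : List α) (a : α), IsMaximalRepeat T w ∧ y = w ++ [a] ∧ y <:+: T}

/-- The left extensions of maximal repeats that appear in `T`. -/
def leftExtensions (T : List α) : Set (List α) :=
  {y | ∃ (w : List α) (a : α), IsMaximalRepeat T w ∧ y = a :: w ∧ y <:+: T}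

/-- `ẽ_T`: the number of right extensions plus the number of left extensions. -/
noncomputable def numExtensions (T : List α) : ℕ :=
  (rightExtensions T).ncard + (leftExtensions T).ncard

/-- `T` ends with a character that appears nowhere else in `T`. -/
def EndsWithUniqueChar (T : List α) : Prop := ∃ (S : List α) (d : α), T = S ++ [d] ∧ d ∉ S

/-! ### CDAWG -/

/-- The class of `x` for `≡_L`: the strings with the same beginning positions in `T`. -/
def classL (T x : List α) : Set (List α) := {y | begPos T y = begPos T x}

/-- The class of `x` for `≡_R`: the strings with the same ending positions in `T`. -/
def classR (T x : List α) : Set (List α) := {y | endPos T y = endPos T x}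

/-- `y` is a longest member of the set `S`. -/
def IsLongest (S : Set (List α)) (y : List α) : Prop := y ∈ S ∧ ∀ z ∈ S, z.length ≤ y.length

/-- `y` is the longest member of the `≡_L`-class of some substring of `T`. -/
def IsLRep (T y : List α) : Prop := ∃ x : List α, x <:+: T ∧ IsLongest (classL T x) y

/-- The nodes of `CDAWG(T)`. -/
def IsCNode (T : List α) (c : Set (List α)) : Prop := ∃ y : List α, IsLRep T y ∧ c = classR T y

/-- The edges `(c, x, c')` of `CDAWG(T)`: from the class of `y` (with `y` longest in its
`≡_L`-class) there is one outgoing edge for each character `a` with `ya` a substring of `T`; its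
label `x` extends `y` to the longest member `yx` of the `≡_L`-class of `ya`. -/
def IsCEdge (T : List α) (c : Set (List α)) (x : List α) (c' : Set (List α)) : Prop :=
  ∃ (y : List α) (a : α), IsLRep T y ∧ c = classR T y ∧ y ++ [a] <:+: T ∧
    IsLongest (classL T (y ++ [a])) (y ++ x) ∧ c' = classR T (y ++ x)

/-- `Spells T c z`: a path of `CDAWG(T)` from the source to the node `c` spells out `z`. -/
inductive Spells (T : List α) : Set (List α) → List α → Prop
  | source : Spells T (classR T []) []
  | step {c c' : Set (List α)} {z x : List α} :
      Spells T c z → IsCEdge T c x c' → Spells T c' (z ++ x)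

/-! ### L-CDAWG -/

/-- A position in `CDAWG(T)`: the node `base` if `off = []`; otherwise the point inside the
outgoing edge of `base` whose label has `off` as a proper prefix, reached after reading `off`. -/
@[ext]
structure Pos (α : Type u) where
  base : Set (List α)
  off : List α

/-- Type-1 nodes: the nodes of `CDAWG(T)`. -/
def IsType1 (T : List α) (v : Pos α) : Prop := IsCNode T v.base ∧ v.off = []

/-- `v` is the type-2 node representing `a u`, where `u` is the value (longest member) of a type-1
node: `a u` is a substring of `T` and the path spelling out `a u` ends at `v`, in the middle of an
edge. -/
def IsType2For (T : List α) (v : Pos α) (a : α) (u : List α) : Prop :=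
  (∃ c, IsCNode T c ∧ IsLongest c u) ∧ a :: u <:+: T ∧
    (∃ z, Spells T v.base z ∧ a :: u = z ++ v.off) ∧
    v.off ≠ [] ∧ ∃ x c', IsCEdge T v.base x c' ∧ v.off <+: x ∧ v.off ≠ x

def IsType2 (T : List α) (v : Pos α) : Prop := ∃ a u, IsType2For T v a u

/-- The nodes of `L-CDAWG(T)`. -/
def IsNode (T : List α) (v : Pos α) : Prop := IsType1 T v ∨ IsType2 T v

/-- An edge from `hi` to `lo`, with its original label string. -/
@[ext]
structure Edge (α : Type u) where
  hi : Pos α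
  lab : List α
  lo : Pos α

/-- The string length of an edge. -/
def Edge.slen (e : Edge α) : ℕ := e.lab.length

/-- The edges of `L-CDAWG(T)`: the pieces into which the type-2 nodes split the edges of
`CDAWG(T)`. -/
def IsEdge (T : List α) (e : Edge α) : Prop :=
  IsNode T e.hi ∧ IsNode T e.lo ∧ e.lab ≠ [] ∧
    (∃ x c', IsCEdge T e.hi.base x c' ∧
      ((e.hi.off ++ e.lab = x ∧ e.lo = ⟨c', []⟩) ∨
        (e.hi.off ++ e.lab <+: x ∧ e.hi.off ++ e.lab ≠ x ∧
          e.lo = ⟨e.hi.base, e.hi.off ++ e.lab⟩))) ∧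
    ∀ p : List α, p ≠ [] → p <+: e.lab → p ≠ e.lab → ¬ IsNode T ⟨e.hi.base, e.hi.off ++ p⟩

/-- `IsSlink T v w`: the suffix link of `v` is `w`. For a type-1 node, `w` is the node of the
longest suffix of the value of `v` that does not belong to `v`; for the type-2 node representing
`a u` it is the type-1 node of `u`. The source has no suffix link. -/
def IsSlink (T : List α) (v w : Pos α) : Prop :=
  (IsType1 T v ∧ ∃ x, IsLongest v.base x ∧
      ∃ s, IsLongest {y | y <:+ x ∧ y ∉ v.base} s ∧ w = ⟨classR T s, []⟩) ∨
    ∃ a u, IsType2For T v a u ∧ w = ⟨classR T u, []⟩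

/-! ### Paths, edge suffix links and jump links -/

/-- `IsPath T v p w`: the list of edges `p` is a path of `L-CDAWG(T)` from `v` to `w`. -/
def IsPath (T : List α) : Pos α → List (Edge α) → Pos α → Prop
  | v, [], w => v = w
  | v, e :: p, w => IsEdge T e ∧ e.hi = v ∧ IsPath T e.lo p w

/-- The label string of a path. -/
def pathLab (p : List (Edge α)) : List α := p.flatMap Edge.lab

/-- `p` is the edge suffix link of `e`: the path from `slink(e.hi)` obtained by scanning
`lab(e)`. -/
def IsESuf (T : List α) (e : Edge α) (p : List (Edge α)) : Prop :=
  ∃ v w, IsSlink T e.hi v ∧ IsPath T v p w ∧ pathLab p = e.lab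

/-- `IsJump T e p`: `jump(e) = p`, by the recursive definition of jump links. -/
inductive IsJump (T : List α) : Edge α → List (Edge α) → Prop
  | single {e e₁ : Edge α} {p : List (Edge α)} :
      IsEdge T e → 2 ≤ e.slen → IsESuf T e [e₁] → IsJump T e₁ p → IsJump T e p
  | path {e : Edge α} {p : List (Edge α)} :
      IsEdge T e → 2 ≤ e.slen → IsESuf T e p → 2 ≤ p.length → IsJump T e p

/-! ### The machine: a word RAM in the comparison model

A program uses finitely many registers and finitely many arrays of words. Every elementary
operation and every test costs one time unit. The characters are not words: the only access to
them is the test `chr`, which asks whether the first character of the edge numbered by one register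
is smaller than that of the edge numbered by another register. -/

/-- Memory: registers `reg r` and array cells `mem k i`. -/
@[ext]
structure State where
  reg : ℕ → ℕ
  mem : ℕ → ℕ → ℕ

/-- Elementary operations on registers. -/
inductive Op
  | const (n : ℕ)
  | copy (a : ℕ)
  | add (a b : ℕ)
  | sub (a b : ℕ)
  | half (a : ℕ)
  | load (k a : ℕ)

/-- The value computed by an operation; `sub` is truncated and `load k a` reads the cell of the
array `k` whose index is in register `a`. -/
def Op.val (s : State) : Op → ℕ
  | .const n => n
  | .copy a => s.reg a
  | .add a b => s.reg a + s.reg b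
  | .sub a b => s.reg a - s.reg b
  | .half a => s.reg a / 2
  | .load k a => s.mem k (s.reg a)

/-- Tests on registers. -/
inductive Test
  | lt (a b : ℕ)
  | eq (a b : ℕ)
  | chr (a b : ℕ)

/-- Truth of a test; `cmp` is the character comparison. -/
def Test.Holds (cmp : ℕ → ℕ → Prop) (s : State) : Test → Prop
  | .lt a b => s.reg a < s.reg b
  | .eq a b => s.reg a = s.reg b
  | .chr a b => cmp (s.reg a) (s.reg b)

/-- Programs. `set d o` writes the value of `o` to register `d`; `store k a b` writes register `b`
to the cell of array `k` whose index is in register `a`. -/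
inductive Prog
  | set (d : ℕ) (o : Op)
  | store (k a b : ℕ)
  | seq (p q : Prog)
  | ite (c : Test) (p q : Prog)
  | while (c : Test) (p : Prog)

/-- `Exec cmp w p s t s'`: with words of `w` bits, `p` started in `s` halts in `s'` after exactly
`t` time units. A program that computes a number not fitting in a word gets stuck. -/
inductive Exec (cmp : ℕ → ℕ → Prop) (w : ℕ) : Prog → State → ℕ → State → Prop
  | set {d : ℕ} {o : Op} {s : State} : o.val s < 2 ^ w →
      Exec cmp w (.set d o) s 1 ⟨Function.update s.reg d (o.val s), s.mem⟩
  | store {k a b : ℕ} {s : State} :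
      Exec cmp w (.store k a b) s 1
        ⟨s.reg, Function.update s.mem k (Function.update (s.mem k) (s.reg a) (s.reg b))⟩
  | seq {p q : Prog} {s₁ s₂ s₃ : State} {t₁ t₂ : ℕ} :
      Exec cmp w p s₁ t₁ s₂ → Exec cmp w q s₂ t₂ s₃ → Exec cmp w (.seq p q) s₁ (t₁ + t₂) s₃
  | ite_true {c : Test} {p q : Prog} {s s' : State} {t : ℕ} :
      c.Holds cmp s → Exec cmp w p s t s' → Exec cmp w (.ite c p q) s (t + 1) s'
  | ite_false {c : Test} {p q : Prog} {s s' : State} {t : ℕ} :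
      ¬ c.Holds cmp s → Exec cmp w q s t s' → Exec cmp w (.ite c p q) s (t + 1) s'
  | while_true {c : Test} {p : Prog} {s₁ s₂ s₃ : State} {t₁ t₂ : ℕ} :
      c.Holds cmp s₁ → Exec cmp w p s₁ t₁ s₂ → Exec cmp w (.while c p) s₂ t₂ s₃ →
        Exec cmp w (.while c p) s₁ (t₁ + t₂ + 1) s₃
  | while_false {c : Test} {p : Prog} {s : State} :
      ¬ c.Holds cmp s → Exec cmp w (.while c p) s 1 s

/-- All registers and cells hold `w`-bit words. -/
def State.IsWordState (w : ℕ) (s : State) : Prop :=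
  (∀ r, s.reg r < 2 ^ w) ∧ ∀ k i, s.mem k i < 2 ^ w

/-! ### `L-CDAWG(T)` in memory -/

/-- The first character of `e` is smaller than that of `f`. -/
def FirstCharLT [LT α] (e f : Edge α) : Prop :=
  ∃ a b x y, e.lab = a :: x ∧ f.lab = b :: y ∧ a < b

/-- A numbering of the nodes and of the edges of `L-CDAWG(T)`, in which the edges leaving the same
node are numbered by increasing first characters. -/
structure Layout [LT α] (T : List α) where
  N : ℕ
  M : ℕ
  node : Fin N ≃ {v : Pos α // IsNode T v}
  edge : Fin M ≃ {e : Edge α // IsEdge T e}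
  sorted : ∀ i j : Fin M, i < j → (edge i).1.hi = (edge j).1.hi →
    FirstCharLT (edge i).1 (edge j).1

/-- The comparison of first characters of numbered edges. -/
def Layout.cmp [LT α] {T : List α} (G : Layout T) (i j : ℕ) : Prop :=
  ∃ (hi : i < G.M) (hj : j < G.M), FirstCharLT (G.edge ⟨i, hi⟩).1 (G.edge ⟨j, hj⟩).1

/-- The state `s` stores `L-CDAWG(T)`: registers 0 and 1 hold the numbers of nodes and edges;
arrays 0, 1, 2, 3 hold for each node its type, its suffix link, and the bounds of the interval of
the numbers of its outgoing edges; arrays 4, 5, 6 hold for each edge `e` its end points `e.hi`,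
`e.lo` and its string length. The text and the edge labels are not stored. -/
structure Layout.Stored [LT α] {T : List α} (G : Layout T) (s : State) : Prop where
  numNodes : s.reg 0 = G.N
  numEdges : s.reg 1 = G.M
  type1 : ∀ v : Fin G.N, IsType1 T (G.node v).1 → s.mem 0 v = 1
  type2 : ∀ v : Fin G.N, IsType2 T (G.node v).1 → s.mem 0 v = 2
  slink : ∀ v v' : Fin G.N, IsSlink T (G.node v).1 (G.node v').1 → s.mem 1 v = v'
  out : ∀ (v : Fin G.N) (i : ℕ), (s.mem 2 v ≤ i ∧ i < s.mem 3 v) ↔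
    ∃ h : i < G.M, (G.edge ⟨i, h⟩).1.hi = (G.node v).1
  hi : ∀ (i : Fin G.M) (v : Fin G.N), (G.edge i).1.hi = (G.node v).1 → s.mem 4 i = v
  lo : ∀ (i : Fin G.M) (v : Fin G.N), (G.edge i).1.lo = (G.node v).1 → s.mem 5 i = v
  slen : ∀ i : Fin G.M, s.mem 6 i = (G.edge i).1.slen

/-- `ListAt s a l`: the linked list starting at the address `a` has the entries `l`. A cell at
address `a ≠ 0` has its entry in array 8 and the address of the next cell in array 9; the address
`0` is the empty list. -/
inductive ListAt (s : State) : ℕ → List ℕ → Prop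
  | nil : ListAt s 0 []
  | cons {a : ℕ} {l : List ℕ} :
      a ≠ 0 → ListAt s (s.mem 9 a) l → ListAt s a (s.mem 8 a :: l)

/-- All jump links are stored: for every edge with string length at least 2, the entry of array 7
is the address of a linked list of the numbers of the edges of its jump path. -/
def Layout.JumpsStored [LT α] {T : List α} (G : Layout T) (s : State) : Prop :=
  ∀ (i : Fin G.M) (p : List (Edge α)), 2 ≤ (G.edge i).1.slen → IsJump T (G.edge i).1 p →
    ∃ l : List (Fin G.M), l.map (fun j => (G.edge j).1) = p ∧
      ListAt s (s.mem 7 i) (l.map (fun j => (j : ℕ)))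

end LCDAWG

universe u

open LCDAWG

namespace LCDAWG

variable {α : Type u}

/-! ### Lists -/

/-! Everything is expressed through right-maximal substrings, those whose occurrences are not all
followed by the same character. They are exactly the strings spelled by paths from the source to
type-1 nodes, and a CDAWG edge leads from one of them to its next right-maximal extension
(`isLRep_iff`, `isCEdge_iff`).

The heart is `IsEdge.nextR_of_headAt`. Let `a s` be the shortest string of the upper end of an edge
`e`; its suffix link is then the node of `s`. Reading `lab(e)` after `s` arrives at a right-maximal
string and meets none strictly in between: if `s p` were one, it would be the value of a node and `a
s p` would give a type-2 node inside `e`. So `esuf(e)` is the cut-up form of one CDAWG edge, a chain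
through type-2 nodes ending at a type-1 node (`IsEdge.exists_esuf`). Edges from the source have
length 1, so a long edge does have a suffix link at its upper end. Occurrence counts grow strictly
along suffix links, so the recursion for `jump` ends (`IsEdge.exists_jump`).

For the algorithm, a type-2 node has one outgoing edge, so a chain is determined by its first edge.
One cell per edge, pointing to the cell of the following piece, serves all jump lists at once
(`Layout.Cells.listAt`). The first edge of `esuf(e)` is found by binary search among at most `σ`
outgoing edges (`linkEdge_spec`). If `esuf(e)` is a single edge, that edge is followed until a known
jump link appears, which is then copied back to every edge passed; each edge is resolved only once,
so this is linear in total (`resolveEdge_spec`). Finally, edges leaving type-1 nodes inject into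
right extensions and edges leaving type-2 nodes into left extensions of maximal repeats, so there
are at most `ẽ_T` edges (`card_edges_le`). -/

theorem exists_isLongest {S : Set (List α)} (hS : S.Nonempty) (n : ℕ)
    (hn : ∀ x ∈ S, x.length ≤ n) : ∃ x, IsLongest S x := by
  classical
  obtain ⟨y, hy⟩ := hS
  obtain ⟨x, hx, hxl⟩ := Nat.findGreatest_spec (P := fun k => ∃ x ∈ S, x.length = k)
    (hn y hy) ⟨y, hy, rfl⟩
  exact ⟨x, hx, fun z hz => hxl ▸ Nat.le_findGreatest (hn z hz) ⟨z, hz, rfl⟩⟩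

theorem exists_minimal_prefix_of (P : List α → Prop) {r : List α} (hr : P r) :
    ∃ p, p <+: r ∧ P p ∧ ∀ q, q <+: p → q ≠ p → ¬ P q := by
  induction hn : r.length using Nat.strong_induction_on generalizing r with
  | _ n ih =>
    subst hn
    by_cases h : ∃ q, q <+: r ∧ q ≠ r ∧ P q
    · obtain ⟨q, hq, hne, hP⟩ := h
      have hlt : q.length < r.length :=
        lt_of_le_of_ne hq.length_le fun h => hne (hq.eq_of_length h)
      obtain ⟨p, hp, h⟩ := ih _ hlt hP rfl
      exact ⟨p, hp.trans hq, h⟩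
    · exact ⟨r, List.prefix_rfl, hr, fun q hq hne hP => h ⟨q, hq, hne, hP⟩⟩

/-! ### Occurrences -/

theorem mem_begPos_iff {T x : List α} {i : ℕ} :
    i ∈ begPos T x ↔ ∃ p q, T = p ++ x ++ q ∧ i = p.length := by
  constructor
  · rintro ⟨hi, q, hq⟩
    refine ⟨T.take i, q, ?_, by simp [hi]⟩
    rw [List.append_assoc, hq, List.take_append_drop]
  · rintro ⟨p, q, rfl, rfl⟩
    refine ⟨by simp, ?_⟩
    simp [List.append_assoc]

theorem mem_endPos_iff {T x : List α} {j : ℕ} :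
    j ∈ endPos T x ↔ ∃ p q, T = p ++ x ++ q ∧ j = p.length + x.length := by
  constructor
  · rintro ⟨hj, p, hp⟩
    refine ⟨p, T.drop j, ?_, ?_⟩
    · rw [hp, List.take_append_drop]
    · have := congrArg List.length hp
      simp at this
      omega
  · rintro ⟨p, q, rfl, rfl⟩
    refine ⟨by simp, ?_⟩
    rw [← List.length_append, List.take_left']
    · exact List.suffix_append _ _
    · rfl

theorem endPos_eq_image (T x : List α) : endPos T x = (· + x.length) '' begPos T x := by
  ext j
  rw [mem_endPos_iff]
  constructor
  · rintro ⟨p, q, h, rfl⟩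
    exact ⟨p.length, mem_begPos_iff.2 ⟨p, q, h, rfl⟩, rfl⟩
  · rintro ⟨i, hi, rfl⟩
    obtain ⟨p, q, h, rfl⟩ := mem_begPos_iff.1 hi
    exact ⟨p, q, h, rfl⟩

theorem mem_begPos_iff_add {T x : List α} {i : ℕ} :
    i ∈ begPos T x ↔ i + x.length ∈ endPos T x := by
  rw [endPos_eq_image]
  exact (Function.Injective.mem_set_image (add_left_injective x.length)).symm

theorem length_le_of_mem_endPos {T x : List α} {j : ℕ} (h : j ∈ endPos T x) : x.length ≤ j := by
  obtain ⟨p, q, -, rfl⟩ := mem_endPos_iff.1 h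
  omega

theorem finite_begPos (T x : List α) : (begPos T x).Finite :=
  (Set.finite_Iic T.length).subset fun _ h => h.1

theorem finite_endPos (T x : List α) : (endPos T x).Finite :=
  (Set.finite_Iic T.length).subset fun _ h => h.1

theorem occ_eq_ncard_endPos (T x : List α) : occ T x = (endPos T x).ncard := by
  rw [endPos_eq_image, Set.ncard_image_of_injective _ (add_left_injective _), occ]

theorem infix_iff_endPos {T x : List α} : x <:+: T ↔ (endPos T x).Nonempty := by
  constructor
  · rintro ⟨p, q, h⟩
    exact ⟨_, mem_endPos_iff.2 ⟨p, q, h.symm, rfl⟩⟩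
  · rintro ⟨j, hj⟩
    obtain ⟨p, q, h, -⟩ := mem_endPos_iff.1 hj
    exact ⟨p, q, h.symm⟩

theorem infix_iff_begPos {T x : List α} : x <:+: T ↔ (begPos T x).Nonempty := by
  rw [infix_iff_endPos, endPos_eq_image, Set.image_nonempty]

theorem endPos_subset_of_suffix {T x y : List α} (h : y <:+ x) : endPos T x ⊆ endPos T y :=
  fun _ hj => ⟨hj.1, h.trans hj.2⟩

theorem begPos_subset_of_prefix {T x y : List α} (h : y <+: x) : begPos T x ⊆ begPos T y :=
  fun _ hj => ⟨hj.1, h.trans hj.2⟩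

theorem suffix_of_mem_endPos {T x y : List α} {j : ℕ} (hx : j ∈ endPos T x)
    (hy : j ∈ endPos T y) (h : y.length ≤ x.length) : y <:+ x :=
  List.suffix_of_suffix_length_le hy.2 hx.2 h

theorem prefix_of_mem_begPos {T x y : List α} {j : ℕ} (hx : j ∈ begPos T x)
    (hy : j ∈ begPos T y) (h : y.length ≤ x.length) : y <+: x :=
  List.prefix_of_prefix_length_le hy.2 hx.2 h

theorem mem_endPos_append_singleton {T x : List α} {a : α} {j : ℕ} :
    j + 1 ∈ endPos T (x ++ [a]) ↔ j ∈ endPos T x ∧ T[j]? = some a := by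
  constructor
  · intro h
    obtain ⟨p, q, rfl, hj⟩ := mem_endPos_iff.1 h
    simp only [List.length_append, List.length_singleton] at hj
    obtain rfl : j = p.length + x.length := by omega
    refine ⟨mem_endPos_iff.2 ⟨p, a :: q, by simp, rfl⟩, ?_⟩
    have : p ++ (x ++ [a]) ++ q = (p ++ x) ++ a :: q := by simp
    rw [this, ← List.length_append]
    simp
  · rintro ⟨h, ha⟩
    obtain ⟨p, q, rfl, rfl⟩ := mem_endPos_iff.1 h
    rw [← List.length_append] at ha
    cases q with
    | nil => simp at ha
    | cons b q =>
      simp at ha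
      subst ha
      exact mem_endPos_iff.2 ⟨p, q, by simp, by simp; omega⟩

theorem endPos_append_singleton_eq_of_eq {T x y : List α} (h : endPos T x = endPos T y) (a : α) :
    endPos T (x ++ [a]) = endPos T (y ++ [a]) := by
  ext j
  cases j with
  | zero =>
    constructor <;> intro h <;> simpa using length_le_of_mem_endPos h
  | succ j => rw [mem_endPos_append_singleton, mem_endPos_append_singleton, h]

/-- Equality of ending positions is a right congruence; hence what can be read from a position does
not depend on the string that led there. -/
theorem endPos_append_eq_of_eq {T x y : List α} (h : endPos T x = endPos T y) (p : List α) :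
    endPos T (x ++ p) = endPos T (y ++ p) := by
  induction p generalizing x y with
  | nil => simpa using h
  | cons a p ih => simpa using ih (endPos_append_singleton_eq_of_eq h a)

theorem infix_of_append_left {T x y : List α} (h : x ++ y <:+: T) : x <:+: T :=
  (List.prefix_append x y).isInfix.trans h

theorem infix_congr {T x y : List α} (h : endPos T x = endPos T y) : x <:+: T ↔ y <:+: T := by
  rw [infix_iff_endPos, infix_iff_endPos, h]

theorem self_mem_classR (T x : List α) : x ∈ classR T x := rfl

theorem classR_eq_iff {T x y : List α} : classR T x = classR T y ↔ endPos T x = endPos T y := by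
  constructor
  · intro h
    have : x ∈ classR T y := h ▸ self_mem_classR T x
    exact this
  · intro h
    simp [classR, h]

/-- Strings with a common ending position are suffix-comparable. -/
theorem suffix_total {T x y : List α} {j : ℕ} (hx : j ∈ endPos T x) (hy : j ∈ endPos T y) :
    y <:+ x ∨ x <:+ y := by
  rcases le_total y.length x.length with h | h
  · exact .inl (suffix_of_mem_endPos hx hy h)
  · exact .inr (suffix_of_mem_endPos hy hx h)

/-! ### Right-maximal substrings -/

/-- `x` is followed by the character `c` at all its occurrences. -/
def FollowedBy (T x : List α) (c : α) : Prop := ∀ j ∈ endPos T x, T[j]? = some c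

/-- A right-maximal substring: one whose occurrences are not all followed by the same
character. -/
def RMax (T x : List α) : Prop := x <:+: T ∧ ¬ ∃ c, FollowedBy T x c

theorem RMax.congr {T x y : List α} (h : endPos T x = endPos T y) : RMax T x ↔ RMax T y := by
  simp [RMax, FollowedBy, infix_congr h, h]

theorem RMax.of_subset {T x y : List α} (hx : RMax T x) (h : endPos T x ⊆ endPos T y) :
    RMax T y :=
  ⟨infix_iff_endPos.2 ((infix_iff_endPos.1 hx.1).mono h),
    fun ⟨c, hc⟩ => hx.2 ⟨c, fun j hj => hc j (h hj)⟩⟩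

theorem RMax.of_suffix {T x y : List α} (hx : RMax T x) (h : y <:+ x) : RMax T y :=
  hx.of_subset (endPos_subset_of_suffix h)

/-- No character follows the end of the text, so suffixes of `T` count as right-maximal. This makes
reading forward always end at a right-maximal string. -/
theorem rMax_of_length_mem {T x : List α} (h : T.length ∈ endPos T x) : RMax T x := by
  refine ⟨infix_iff_endPos.2 ⟨_, h⟩, fun ⟨c, hc⟩ => ?_⟩
  simpa using hc _ h

theorem rMax_nil (T : List α) : RMax T [] :=
  rMax_of_length_mem ⟨le_rfl, List.nil_suffix⟩

theorem FollowedBy.begPos_eq {T x : List α} {c : α} (h : FollowedBy T x c) :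
    begPos T (x ++ [c]) = begPos T x := by
  refine (begPos_subset_of_prefix (List.prefix_append _ _)).antisymm fun i hi => ?_
  have hi' := mem_begPos_iff_add.1 hi
  rw [mem_begPos_iff_add]
  simpa [add_assoc] using mem_endPos_append_singleton.2 ⟨hi', h _ hi'⟩

theorem followedBy_of_begPos_subset {T x : List α} {c : α}
    (h : begPos T x ⊆ begPos T (x ++ [c])) : FollowedBy T x c := by
  intro j hj
  rw [endPos_eq_image] at hj
  obtain ⟨i, hi, rfl⟩ := hj
  have := mem_begPos_iff_add.1 (h hi)
  rw [List.length_append, List.length_singleton, ← add_assoc] at this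
  exact (mem_endPos_append_singleton.1 this).2

theorem FollowedBy.eq_of_infix {T x : List α} {c d : α} (h : FollowedBy T x c)
    (hd : x ++ [d] <:+: T) : d = c := by
  obtain ⟨j, hj⟩ := infix_iff_endPos.1 hd
  have hpos := length_le_of_mem_endPos hj
  simp at hpos
  obtain ⟨j, rfl⟩ : ∃ k, j = k + 1 := ⟨j - 1, by omega⟩
  have := mem_endPos_append_singleton.1 hj
  simpa [h _ this.1, eq_comm] using this.2

theorem eq_of_not_rMax {T x : List α} {c d : α} (h : ¬ RMax T x) (hc : x ++ [c] <:+: T)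
    (hd : x ++ [d] <:+: T) : c = d := by
  have : ∃ c, FollowedBy T x c := by
    by_contra hne
    exact h ⟨infix_of_append_left hc, hne⟩
  obtain ⟨b, hb⟩ := this
  rw [hb.eq_of_infix hc, hb.eq_of_infix hd]

/-- A string that is not right-maximal has a forced next character, and appending it loses no
occurrence. -/
theorem begPos_append_eq {T : List α} {q r : List α} (hr : q ++ r <:+: T)
    (h : ∀ p, p <+: r → p ≠ r → ¬ RMax T (q ++ p)) : begPos T (q ++ r) = begPos T q := by
  induction r generalizing q with
  | nil => simp
  | cons c r ih =>
    have hq : ¬ RMax T q := by simpa using h [] List.nil_prefix (by simp)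
    have hqc : q ++ [c] <:+: T := infix_of_append_left (y := r) (by simpa using hr)
    have hf : FollowedBy T q c := by
      by_contra hne
      refine hq ⟨infix_of_append_left hqc, fun ⟨d, hd⟩ => hne ?_⟩
      rwa [hd.eq_of_infix hqc]
    have := ih (q := q ++ [c]) (by simpa using hr) fun p hp hne => by
      have := h (c :: p) (by simpa using hp) (by simpa using hne)
      simpa using this
    rw [← hf.begPos_eq, ← this]
    simp

theorem RMax.isLongest {T x : List α} (h : RMax T x) : IsLongest (classL T x) x := by
  refine ⟨rfl, fun z hz => ?_⟩
  have hz : begPos T z = begPos T x := hz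
  by_contra! hlt
  obtain ⟨i, hi⟩ := infix_iff_begPos.1 h.1
  obtain ⟨r, rfl⟩ := prefix_of_mem_begPos (hz ▸ hi) hi hlt.le
  cases r with
  | nil => simp at hlt
  | cons c r =>
    refine h.2 ⟨c, followedBy_of_begPos_subset ?_⟩
    rw [← hz]
    exact begPos_subset_of_prefix ⟨r, by simp⟩

/-- A substring can be lengthened inside its `≡_L`-class exactly when one character follows all its
occurrences. -/
theorem isLRep_iff {T x : List α} : IsLRep T x ↔ RMax T x := by
  constructor
  · rintro ⟨y, hy, hx, hmax⟩
    have hx : begPos T x = begPos T y := hx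
    refine ⟨by rwa [infix_iff_begPos, hx, ← infix_iff_begPos], fun ⟨c, hc⟩ => ?_⟩
    have := hmax (x ++ [c]) (hc.begPos_eq.trans hx)
    simp at this
  · exact fun h => ⟨x, h.1, h.isLongest⟩

/-! ### The next right-maximal extension -/

/-- `w ++ r` is the shortest right-maximal proper extension of `w` along `r`. -/
structure NextR (T w r : List α) : Prop where
  ne_nil : r ≠ []
  rMax : RMax T (w ++ r)
  not_rMax : ∀ p, p ≠ [] → p <+: r → p ≠ r → ¬ RMax T (w ++ p)

theorem NextR.congr {T w w' r : List α} (h : NextR T w r) (he : endPos T w = endPos T w') :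
    NextR T w' r :=
  ⟨h.ne_nil, (RMax.congr (endPos_append_eq_of_eq he r)).1 h.rMax, fun p h1 h2 h3 hp =>
    h.not_rMax p h1 h2 h3 ((RMax.congr (endPos_append_eq_of_eq he p)).2 hp)⟩

theorem NextR.begPos_eq {T w r : List α} {a : α} (h : NextR T w (a :: r)) :
    begPos T (w ++ a :: r) = begPos T (w ++ [a]) := by
  have := begPos_append_eq (T := T) (q := w ++ [a]) (r := r) (by simpa using h.rMax.1)
    fun p hp hne => by
      simpa using h.not_rMax (a :: p) (by simp) (by simpa using hp) (by simpa using hne)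
  simpa using this

/-- Both extensions begin exactly where `w ++ [a]` does, so one is a prefix of the other; minimality
then forces equality. -/
theorem NextR.unique {T w r r' : List α} {a : α} (h : NextR T w (a :: r))
    (h' : NextR T w (a :: r')) : r = r' := by
  obtain ⟨i, hi⟩ := infix_iff_begPos.1 h.rMax.1
  have hi' : i ∈ begPos T (w ++ a :: r') := by rwa [h'.begPos_eq, ← h.begPos_eq]
  rcases le_total (w ++ a :: r').length (w ++ a :: r).length with hl | hl
  · have := (List.prefix_append_right_inj w).1 (prefix_of_mem_begPos hi hi' hl)
    by_contra hne
    exact h.not_rMax _ (by simp) this (by simpa [eq_comm] using hne) h'.rMax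
  · have := (List.prefix_append_right_inj w).1 (prefix_of_mem_begPos hi' hi hl)
    by_contra hne
    exact h'.not_rMax _ (by simp) this (by simpa using hne) h.rMax

theorem exists_nextR {T w : List α} {c : α} (h : w ++ [c] <:+: T) : ∃ r, NextR T w (c :: r) := by
  obtain ⟨p, q, hT⟩ := h
  have hq : RMax T (w ++ [c] ++ q) := by
    refine rMax_of_length_mem (mem_endPos_iff.2 ⟨p, [], by simp [← hT], ?_⟩)
    rw [← hT]
    simp only [List.length_append]
    omega
  obtain ⟨r, hr, hmax, hmin⟩ := exists_minimal_prefix_of (fun r => RMax T (w ++ [c] ++ r)) hq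
  refine ⟨r, by simp, by simpa using hmax, fun p hp hpr hne => ?_⟩
  cases p with
  | nil => simp at hp
  | cons a p =>
    obtain ⟨rfl, hpr'⟩ := List.cons_prefix_cons.1 hpr
    simpa using hmin p hpr' (by simpa using hne)

theorem isCEdge_iff {T : List α} {c c' : Set (List α)} {x : List α} :
    IsCEdge T c x c' ↔
      ∃ y, RMax T y ∧ c = classR T y ∧ NextR T y x ∧ c' = classR T (y ++ x) := by
  constructor
  · rintro ⟨y, a, hy, hc, hya, hlong, hc'⟩
    have hbeg : begPos T (y ++ x) = begPos T (y ++ [a]) := hlong.1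
    have hmax : RMax T (y ++ x) := isLRep_iff.1 ⟨_, hya, hlong⟩
    obtain ⟨i, hi⟩ := infix_iff_begPos.1 hmax.1
    have hpre := prefix_of_mem_begPos hi (hbeg ▸ hi) (hlong.2 _ rfl)
    obtain ⟨r, rfl⟩ := (List.prefix_append_right_inj y).1 hpre
    refine ⟨y, isLRep_iff.1 hy, hc, ⟨by simp, hmax, ?_⟩, hc'⟩
    rintro p hp hpx hne hpm
    obtain ⟨s, hs⟩ := hpx
    cases s with
    | nil => exact hne (by simpa using hs)
    | cons d s =>
      -- All strings between `ya` and `yx` have the same beginning positions, so an intermediate one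
      -- is always followed by the next letter of `x`.
      refine hpm.2 ⟨d, followedBy_of_begPos_subset ?_⟩
      have h1 : begPos T (y ++ ([a] ++ r)) ⊆ begPos T (y ++ p ++ [d]) :=
        begPos_subset_of_prefix ⟨s, by simp [← hs]⟩
      refine subset_trans (subset_trans ?_ hbeg.ge) h1
      refine begPos_subset_of_prefix ?_
      cases p with
      | nil => simp at hp
      | cons b p =>
        simp at hs
        simp [hs.1]
  · rintro ⟨y, hy, hc, hx, hc'⟩
    cases x with
    | nil => exact absurd rfl hx.ne_nil
    | cons a r =>
      refine ⟨y, a, isLRep_iff.2 hy, hc,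
        infix_of_append_left (y := r) (by simpa using hx.rMax.1), ?_, hc'⟩
      have := hx.rMax.isLongest
      rwa [classL, hx.begPos_eq] at this

theorem Spells.rMax {T : List α} {c : Set (List α)} {z : List α} (h : Spells T c z) :
    RMax T z ∧ c = classR T z := by
  induction h with
  | source => exact ⟨rMax_nil T, rfl⟩
  | step _ he ih =>
    obtain ⟨hz, rfl⟩ := ih
    obtain ⟨y, hy, hc, hx, rfl⟩ := isCEdge_iff.1 he
    have := classR_eq_iff.1 hc
    exact ⟨(hx.congr this.symm).rMax,
      classR_eq_iff.2 (endPos_append_eq_of_eq this.symm _)⟩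

theorem exists_rMax_prefix_of {T w : List α} (P : List α → Prop) (h : P []) :
    ∃ z r, w = z ++ r ∧ RMax T z ∧ P z ∧
      ∀ p, p ≠ [] → p <+: r → P (z ++ p) → ¬ RMax T (z ++ p) := by
  obtain ⟨z, hz, hmax⟩ := exists_isLongest (S := {z | z <+: w ∧ RMax T z ∧ P z})
    ⟨[], List.nil_prefix, rMax_nil T, h⟩ w.length fun x hx => hx.1.length_le
  obtain ⟨⟨r, rfl⟩, hzm, hzP⟩ := hz
  refine ⟨z, r, rfl, hzm, hzP, fun p hp hpr hP hm => ?_⟩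
  have := hmax (z ++ p) ⟨(List.prefix_append_right_inj z).2 hpr, hm, hP⟩
  simp at this
  exact hp this

/-- The last edge of the path starts at the longest right-maximal proper prefix of `z`. -/
theorem RMax.spells {T z : List α} (h : RMax T z) : Spells T (classR T z) z := by
  induction hn : z.length using Nat.strong_induction_on generalizing z with
  | _ n ih =>
    subst hn
    by_cases hz : z = []
    · subst hz
      exact .source
    · obtain ⟨y, r, rfl, hy, hyz, hmin⟩ :=
        exists_rMax_prefix_of (T := T) (w := z) (fun y => y ≠ z) (Ne.symm hz)
      have hr : r ≠ [] := by rintro rfl; simp at hyz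
      have hlt : y.length < (y ++ r).length := by simpa [List.length_pos_iff] using hr
      refine .step (ih _ hlt hy rfl) (isCEdge_iff.2 ⟨y, hy, rfl, ⟨hr, h, ?_⟩, rfl⟩)
      intro p hp hpr hne
      exact hmin p hp hpr (by simpa using hne)

/-! ### Positions and the strings that they represent -/

/-- The position `v` is reached from the source by reading the substring `w`. -/
structure At (T : List α) (v : Pos α) (w : List α) : Prop where
  isInfix : w <:+: T
  exists_base : ∃ z, RMax T z ∧ v.base = classR T z ∧ w = z ++ v.off ∧
    ∀ p, p ≠ [] → p <+: v.off → ¬ RMax T (z ++ p)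

/-- The string `z` underlying the base is forced: it is the longest right-maximal prefix of `w`. -/
theorem At.unique {T w : List α} {v v' : Pos α} (h : At T v w) (h' : At T v' w) : v = v' := by
  obtain ⟨z, hz, hb, hw, hmin⟩ := h.exists_base
  obtain ⟨z', hz', hb', hw', hmin'⟩ := h'.exists_base
  have hpz : z <+: w := ⟨_, hw.symm⟩
  have hpz' : z' <+: w := ⟨_, hw'.symm⟩
  have key : ∀ {z z' o : List α}, z <+: z' → z' <+: z ++ o → RMax T z' →
      (∀ p, p ≠ [] → p <+: o → ¬ RMax T (z ++ p)) → z' = z := by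
    rintro z _ o ⟨p, rfl⟩ hpo hm hmin
    by_contra hne
    exact hmin p (by simpa using hne) ((List.prefix_append_right_inj z).1 hpo) hm
  obtain rfl : z' = z := by
    rcases List.prefix_or_prefix_of_prefix hpz hpz' with hp | hp
    · exact key hp (hw ▸ hpz') hz' hmin
    · exact (key hp (hw' ▸ hpz) hz hmin').symm
  ext1
  · rw [hb, hb']
  · exact List.append_cancel_left (hw.symm.trans hw')

theorem At.endPos_eq {T w w' : List α} {v : Pos α} (h : At T v w) (h' : At T v w') :
    endPos T w = endPos T w' := by
  obtain ⟨z, -, hb, rfl, -⟩ := h.exists_base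
  obtain ⟨z', -, hb', rfl, -⟩ := h'.exists_base
  exact endPos_append_eq_of_eq (classR_eq_iff.1 (hb ▸ hb')) _

theorem At.exists_followedBy {T w : List α} {v : Pos α} (h : At T v w) (hm : ¬ RMax T w) :
    ∃ c, FollowedBy T w c := by
  by_contra hne
  exact hm ⟨h.isInfix, hne⟩

theorem RMax.at {T z : List α} (h : RMax T z) : At T ⟨classR T z, []⟩ z :=
  ⟨h.1, z, h, rfl, by simp, fun p hp hpn => absurd (List.prefix_nil.1 hpn) hp⟩

theorem At.append {T w p : List α} {v : Pos α} (h : At T v w) (hp : w ++ p <:+: T)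
    (hmin : ∀ q, q ≠ [] → q <+: p → ¬ RMax T (w ++ q)) : At T ⟨v.base, v.off ++ p⟩ (w ++ p) := by
  obtain ⟨z, hz, hb, hw, hminz⟩ := h.exists_base
  refine ⟨hp, z, hz, hb, by simp [hw], fun q hq hqp => ?_⟩
  rcases List.prefix_or_prefix_of_prefix hqp (List.prefix_append _ _) with h | ⟨q', rfl⟩
  · exact hminz q hq h
  · rw [← List.append_assoc, ← hw]
    rcases eq_or_ne q' [] with rfl | hq'
    · simp only [List.append_nil] at hq ⊢
      rw [hw]
      exact hminz _ hq List.prefix_rfl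
    · exact hmin q' hq' ((List.prefix_append_right_inj _).1 hqp)

theorem At.rMax_iff {T w : List α} {v : Pos α} (h : At T v w) : RMax T w ↔ v.off = [] := by
  obtain ⟨z, hz, -, rfl, hmin⟩ := h.exists_base
  constructor
  · intro hm
    by_contra hne
    exact hmin _ hne List.prefix_rfl hm
  · intro h
    simpa [h] using hz

theorem isType1_iff {T : List α} {v : Pos α} :
    IsType1 T v ↔ ∃ z, RMax T z ∧ v = ⟨classR T z, []⟩ := by
  constructor
  · rintro ⟨⟨y, hy, hb⟩, ho⟩
    exact ⟨y, isLRep_iff.1 hy, Pos.ext hb ho⟩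
  · rintro ⟨z, hz, rfl⟩
    exact ⟨⟨z, isLRep_iff.2 hz, rfl⟩, rfl⟩

theorem RMax.isType1 {T z : List α} (h : RMax T z) : IsType1 T ⟨classR T z, []⟩ :=
  isType1_iff.2 ⟨z, h, rfl⟩

/-- The value of a type-1 node. -/
def IsValue (T u : List α) : Prop := RMax T u ∧ IsLongest (classR T u) u

theorem isValue_iff {T u : List α} : (∃ c, IsCNode T c ∧ IsLongest c u) ↔ IsValue T u := by
  constructor
  · rintro ⟨c, ⟨y, hy, rfl⟩, hu⟩
    have he : endPos T u = endPos T y := hu.1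
    exact ⟨(RMax.congr he).2 (isLRep_iff.1 hy), by rwa [classR_eq_iff.2 he]⟩
  · rintro ⟨hu, hl⟩
    exact ⟨_, ⟨u, isLRep_iff.2 hu, rfl⟩, hl⟩

/-- Ending inside an edge means not being right-maximal; the surrounding CDAWG edge is recovered by
reading on to the next right-maximal extension. -/
theorem isType2For_iff {T : List α} {v : Pos α} {a : α} {u : List α} :
    IsType2For T v a u ↔ IsValue T u ∧ ¬ RMax T (a :: u) ∧ At T v (a :: u) := by
  constructor
  · rintro ⟨hu, hau, ⟨z, hz, hauz⟩, hne, x, c', hx, hpre, hnex⟩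
    obtain ⟨hzm, hb⟩ := hz.rMax
    obtain ⟨y, hy, hb', hnext, -⟩ := isCEdge_iff.1 hx
    have hnz := hnext.congr (classR_eq_iff.1 (hb'.symm.trans hb))
    have hat : At T v (a :: u) := by
      refine ⟨hau, z, hzm, hb, hauz, fun p hp hpo => hnz.not_rMax p hp (hpo.trans hpre) ?_⟩
      rintro rfl
      exact hnex (hpre.eq_of_length (le_antisymm hpre.length_le hpo.length_le))
    exact ⟨isValue_iff.1 hu, fun h => hne (hat.rMax_iff.1 h), hat⟩
  · rintro ⟨hu, hm, hat⟩
    obtain ⟨z, hz, hb, hw, hmin⟩ := hat.exists_base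
    have hne : v.off ≠ [] := fun h => hm (hat.rMax_iff.2 h)
    refine ⟨isValue_iff.2 hu, hat.isInfix, ⟨z, hb ▸ hz.spells, hw⟩, hne, ?_⟩
    obtain ⟨c, hc⟩ := hat.exists_followedBy hm
    have hinf : a :: u ++ [c] <:+: T :=
      infix_iff_begPos.2 (hc.begPos_eq ▸ infix_iff_begPos.1 hat.isInfix)
    obtain ⟨r, hr⟩ := exists_nextR hinf
    refine ⟨v.off ++ c :: r, _, isCEdge_iff.2 ⟨z, hz, hb, ⟨by simp, ?_, ?_⟩, rfl⟩,
      List.prefix_append _ _, by simp⟩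
    · rw [← List.append_assoc, ← hw]
      exact hr.rMax
    · intro p hp hpr hpne
      rcases List.prefix_or_prefix_of_prefix hpr (List.prefix_append _ _) with h | ⟨q, rfl⟩
      · exact hmin p hp h
      · rw [← List.append_assoc, ← hw]
        rcases eq_or_ne q [] with rfl | hq
        · simpa using hm
        · exact hr.not_rMax q hq ((List.prefix_append_right_inj _).1 hpr) (by simpa using hpne)

theorem IsType1.off_eq {T : List α} {v : Pos α} (h : IsType1 T v) : v.off = [] := h.2

theorem IsType2.off_ne {T : List α} {v : Pos α} (h : IsType2 T v) : v.off ≠ [] := by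
  obtain ⟨a, u, h⟩ := h
  exact h.2.2.2.1

theorem IsNode.isType1_iff_off {T : List α} {v : Pos α} (h : IsNode T v) :
    IsType1 T v ↔ v.off = [] :=
  ⟨IsType1.off_eq, fun ho => h.resolve_right fun h2 => h2.off_ne ho⟩

theorem IsNode.exists_at {T : List α} {v : Pos α} (h : IsNode T v) : ∃ w, At T v w := by
  rcases h with h | ⟨a, u, h⟩
  · obtain ⟨z, hz, rfl⟩ := isType1_iff.1 h
    exact ⟨z, hz.at⟩
  · exact ⟨_, (isType2For_iff.1 h).2.2⟩

/-! ### Edges -/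

/-- An edge leaving the position of `w` is the first piece of the label `r` that leads from `w` to
its next right-maximal extension. -/
theorem IsEdge.spec {T w : List α} {e : Edge α} (he : IsEdge T e) (hw : At T e.hi w) :
    At T e.lo (w ++ e.lab) ∧ ∃ r, NextR T w r ∧ e.lab <+: r ∧ (IsType1 T e.lo ↔ e.lab = r) ∧
      (e.lab ≠ r → e.lo = ⟨e.hi.base, e.hi.off ++ e.lab⟩) := by
  obtain ⟨-, hlo, hne, ⟨x, c', hx, hcase⟩, -⟩ := he
  obtain ⟨z, hz, hb, hwz, hmin⟩ := hw.exists_base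
  obtain ⟨y, hy, hb', hnext, hc'⟩ := isCEdge_iff.1 hx
  have heq := classR_eq_iff.1 (hb'.symm.trans hb)
  have hnz := hnext.congr heq
  have hpx : e.hi.off ++ e.lab <+: x := by
    rcases hcase with h | h
    · exact h.1 ▸ List.prefix_rfl
    · exact h.1
  obtain ⟨s, hs⟩ := hpx
  subst hwz
  have hN : NextR T (z ++ e.hi.off) (e.lab ++ s) := by
    refine ⟨by simp [hne], ?_, fun p hp hpr hpne => ?_⟩
    · have := hnz.rMax
      rw [← hs] at this
      simpa using this
    · have := hnz.not_rMax (e.hi.off ++ p) (by simp [hp]) (by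
        rw [← hs, List.append_assoc]
        exact (List.prefix_append_right_inj _).2 hpr) (by
        rw [← hs, List.append_assoc]
        simpa using hpne)
      simpa using this
  rcases hcase with ⟨h1, h2⟩ | ⟨h1, h2, h3⟩
  · have hs0 : s = [] := by
      rw [← h1] at hs
      simpa using hs
    subst hs0
    have hzx : RMax T (z ++ e.hi.off ++ e.lab) := by simpa using hN.rMax
    have hlo' : e.lo = ⟨classR T (z ++ e.hi.off ++ e.lab), []⟩ := by
      rw [h2, hc', List.append_assoc, h1, classR_eq_iff.2 (endPos_append_eq_of_eq heq x)]
    refine ⟨hlo' ▸ hzx.at, e.lab ++ [], hN, by simp, ?_, by simp⟩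
    simp only [List.append_nil, iff_true]
    exact hlo' ▸ hzx.isType1
  · have hs0 : s ≠ [] := by
      rintro rfl
      simp [h2] at hs
    have hlab : e.lab ≠ e.lab ++ s := by simpa using hs0
    refine ⟨⟨?_, z, hz, by rw [h3, hb], by rw [h3, List.append_assoc], ?_⟩, _, hN,
      List.prefix_append _ _, ?_, fun _ => h3⟩
    · refine infix_of_append_left (y := s) ?_
      simpa using hN.rMax.1
    · rw [h3]
      refine fun p hp hpp => hnz.not_rMax p hp (hpp.trans h1) ?_
      rintro rfl
      exact h2 (List.IsPrefix.eq_of_length h1 (le_antisymm h1.length_le hpp.length_le))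
    · rw [hlo.isType1_iff_off, h3]
      simp [hne, hlab]

theorem IsEdge.at_lo {T w : List α} {e : Edge α} (he : IsEdge T e) (hw : At T e.hi w) :
    At T e.lo (w ++ e.lab) := (he.spec hw).1

theorem IsEdge.not_rMax {T w : List α} {e : Edge α} (he : IsEdge T e) (hw : At T e.hi w)
    {p : List α} (hp : p ≠ []) (hpe : p <+: e.lab) (hne : p ≠ e.lab) : ¬ RMax T (w ++ p) := by
  obtain ⟨-, r, hr, hpr, -, -⟩ := he.spec hw
  refine hr.not_rMax p hp (hpe.trans hpr) ?_
  rintro rfl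
  exact hne (hpe.eq_of_length (le_antisymm hpe.length_le hpr.length_le))

theorem IsEdge.nodes {T : List α} {e : Edge α} (he : IsEdge T e) : IsNode T e.hi ∧ IsNode T e.lo :=
  ⟨he.1, he.2.1⟩

theorem IsEdge.exists_lab_eq {T : List α} {e : Edge α} (he : IsEdge T e) :
    ∃ c r, e.lab = c :: r := List.exists_cons_of_ne_nil he.2.2.1

theorem IsEdge.infix_first {T w : List α} {e : Edge α} (he : IsEdge T e) (hw : At T e.hi w)
    {c : α} {r : List α} (hc : e.lab = c :: r) : w ++ [c] <:+: T := by
  refine infix_of_append_left (y := r) ?_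
  simpa [hc] using (he.at_lo hw).isInfix

/-- An edge is determined by its upper end and its first character. -/
theorem IsEdge.unique {T : List α} {e e' : Edge α} (he : IsEdge T e) (he' : IsEdge T e')
    (hhi : e.hi = e'.hi) {c : α} {r r' : List α} (hc : e.lab = c :: r) (hc' : e'.lab = c :: r') :
    e = e' := by
  obtain ⟨w, hw⟩ := he.nodes.1.exists_at
  obtain ⟨hlo, s, hs, hp, -, hbase⟩ := he.spec hw
  obtain ⟨hlo', s', hs', hp', -, hbase'⟩ := he'.spec (hhi ▸ hw)
  have hss : s = s' := by
    obtain ⟨q, rfl⟩ := hp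
    obtain ⟨q', rfl⟩ := hp'
    rw [hc] at hs ⊢
    rw [hc'] at hs' ⊢
    simp only [List.cons_append] at hs hs' ⊢
    rw [hs.unique hs']
  subst hss
  have hlab : e.lab = e'.lab := by
    by_contra hne
    rcases List.prefix_or_prefix_of_prefix hp hp' with h | h
    · refine he'.2.2.2.2 e.lab he.2.2.1 h hne ?_
      rw [← hhi, ← hbase ?_]
      · exact he.nodes.2
      · rintro rfl
        exact hne (h.eq_of_length (le_antisymm h.length_le hp'.length_le))
    · refine he.2.2.2.2 e'.lab he'.2.2.1 h (Ne.symm hne) ?_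
      rw [hhi, ← hbase' ?_]
      · exact he'.nodes.2
      · rintro rfl
        exact hne (h.eq_of_length (le_antisymm h.length_le hp.length_le)).symm
  exact Edge.ext hhi hlab (hlo.unique (hlab ▸ hlo'))

theorem exists_edge {T w : List α} {v : Pos α} {c : α} (hv : IsNode T v) (hw : At T v w)
    (hc : w ++ [c] <:+: T) : ∃ e, IsEdge T e ∧ e.hi = v ∧ ∃ r, e.lab = c :: r := by
  obtain ⟨z, hz, hb, hwz, hmin⟩ := hw.exists_base
  obtain ⟨r, hr⟩ := exists_nextR hc
  have hx : NextR T z (v.off ++ c :: r) := by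
    refine ⟨by simp, ?_, fun p hp hpr hne => ?_⟩
    · rw [← List.append_assoc, ← hwz]
      exact hr.rMax
    · rcases List.prefix_or_prefix_of_prefix hpr (List.prefix_append _ _) with h | ⟨q, rfl⟩
      · exact hmin p hp h
      · rcases eq_or_ne q [] with rfl | hq
        · simp only [List.append_nil] at hp ⊢
          exact hmin _ hp List.prefix_rfl
        · rw [← List.append_assoc, ← hwz]
          exact hr.not_rMax q hq ((List.prefix_append_right_inj _).1 hpr) (by simpa using hne)
  have hce := isCEdge_iff.2 ⟨z, hz, hb, hx, rfl⟩
  have hlast : IsNode T ⟨classR T (z ++ (v.off ++ c :: r)), []⟩ := .inl hx.rMax.isType1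
  -- `p` leads to the first node met on the rest of the CDAWG edge; the disjunct `p = c :: r` stands
  -- for the end of that edge.
  obtain ⟨p, hp, ⟨hpne, hpcase⟩, hpmin⟩ := exists_minimal_prefix_of
    (fun p => p ≠ [] ∧ (p = c :: r ∨ IsNode T ⟨v.base, v.off ++ p⟩)) (r := c :: r) (by simp)
  have hint : ∀ q : List α, q ≠ [] → q <+: p → q ≠ p → ¬ IsNode T ⟨v.base, v.off ++ q⟩ :=
    fun q hq hqp hqne hn => hpmin q hqp hqne ⟨hq, .inr hn⟩
  have hhead : ∃ r', p = c :: r' := by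
    cases p with
    | nil => exact absurd rfl hpne
    | cons d p => exact ⟨p, by rw [(List.cons_prefix_cons.1 hp).1]⟩
  by_cases hpr : p = c :: r
  · subst hpr
    exact ⟨⟨v, c :: r, ⟨_, []⟩⟩, ⟨hv, hlast, by simp, ⟨_, _, hce, .inl ⟨rfl, rfl⟩⟩, hint⟩, rfl,
      hhead⟩
  · have hn := hpcase.resolve_left hpr
    exact ⟨⟨v, p, ⟨v.base, v.off ++ p⟩⟩, ⟨hv, hn, hpne, ⟨_, _, hce, .inr
      ⟨(List.prefix_append_right_inj _).2 hp, by simpa using hpr, rfl⟩⟩, hint⟩, rfl, hhead⟩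

theorem IsPath.unique {T : List α} {v w w' : Pos α} {p p' : List (Edge α)} (h : IsPath T v p w)
    (h' : IsPath T v p' w') (hl : pathLab p = pathLab p') : p = p' := by
  induction p generalizing v p' with
  | nil =>
    cases p' with
    | nil => rfl
    | cons e p' =>
      have := h'.1.2.2.1
      simp [pathLab] at hl
      exact absurd hl.1 this
  | cons e p ih =>
    cases p' with
    | nil =>
      have := h.1.2.2.1
      simp [pathLab] at hl
      exact absurd hl.1 this
    | cons e' p' =>
      obtain ⟨c, r, hc⟩ := h.1.exists_lab_eq
      obtain ⟨c', r', hc'⟩ := h'.1.exists_lab_eq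
      have hl' : e.lab ++ pathLab p = e'.lab ++ pathLab p' := by simpa [pathLab] using hl
      obtain rfl : c = c' := by
        have := hl'
        rw [hc, hc'] at this
        simp at this
        exact this.1
      obtain rfl := h.1.unique h'.1 (h.2.1.trans h'.2.1.symm) hc hc'
      rw [ih h.2.2 h'.2.2 (List.append_cancel_left hl')]

/-- A path of edges whose interior nodes have type 2 and whose last node has type 1. -/
inductive TypeChain (T : List α) : List (Edge α) → Prop
  | single {e : Edge α} : IsEdge T e → IsType1 T e.lo → TypeChain T [e]
  | cons {e e' : Edge α} {p : List (Edge α)} : IsEdge T e → IsType2 T e.lo → e'.hi = e.lo →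
      TypeChain T (e' :: p) → TypeChain T (e :: e' :: p)

theorem exists_typeChain {T w r : List α} {v : Pos α} (hv : IsNode T v) (hw : At T v w)
    (hr : NextR T w r) : ∃ e p x, IsPath T v (e :: p) x ∧ TypeChain T (e :: p) ∧
      pathLab (e :: p) = r := by
  induction hn : r.length using Nat.strong_induction_on generalizing v w r with
  | _ n ih =>
    subst hn
    obtain ⟨c, r, rfl⟩ := List.exists_cons_of_ne_nil hr.ne_nil
    obtain ⟨e, he, rfl, q, hq⟩ := exists_edge (c := c) hv hw
      (infix_of_append_left (y := r) (by simpa using hr.rMax.1))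
    obtain ⟨hlo, s, hs, hp, h1, -⟩ := he.spec hw
    obtain rfl : s = c :: r := by
      obtain ⟨q', rfl⟩ := hp
      rw [hq] at hs ⊢
      rw [List.cons_append] at hs ⊢
      rw [hr.unique hs]
    by_cases hlab : e.lab = c :: r
    · exact ⟨e, [], e.lo, ⟨he, rfl, rfl⟩, .single he (h1.2 hlab), by simp [pathLab, hlab]⟩
    · obtain ⟨q', hq'⟩ := hp
      have hne : q' ≠ [] := by
        rintro rfl
        exact hlab (by simpa using hq')
      have hN : NextR T (w ++ e.lab) q' := by
        refine ⟨hne, by simpa [hq'] using hr.rMax, fun p hp hpq hpne => ?_⟩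
        have := hr.not_rMax (e.lab ++ p) (by simp [hp])
          (hq' ▸ (List.prefix_append_right_inj _).2 hpq) (by simpa [← hq'] using hpne)
        simpa using this
      have hlen : q'.length < (c :: r).length := by
        rw [← hq', hq]
        simp
      have h2 : IsType2 T e.lo := he.nodes.2.resolve_left fun h => hlab (h1.1 h)
      obtain ⟨e', p, x, hpath, hch, hpl⟩ := ih _ hlen he.nodes.2 hlo hN rfl
      refine ⟨e, e' :: p, x, ⟨he, rfl, hpath⟩, .cons he h2 hpath.2.1 hch, ?_⟩
      rw [pathLab, List.flatMap_cons, ← pathLab, hpl, hq']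

/-- A node of type 2 has exactly one outgoing edge. -/
theorem IsType2.edge_unique {T : List α} {v : Pos α} (hv : IsType2 T v) {e e' : Edge α}
    (he : IsEdge T e) (he' : IsEdge T e') (h : e.hi = v) (h' : e'.hi = v) : e = e' := by
  subst h
  obtain ⟨a, u, ha⟩ := hv
  obtain ⟨-, hm, hat⟩ := isType2For_iff.1 ha
  obtain ⟨c, r, hc⟩ := he.exists_lab_eq
  obtain ⟨c', r', hc'⟩ := he'.exists_lab_eq
  obtain rfl := eq_of_not_rMax hm (he.infix_first hat hc) (he'.infix_first (h' ▸ hat) hc')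
  exact he.unique he' h'.symm hc hc'

theorem IsType2.exists_edge {T : List α} {v : Pos α} (hv : IsType2 T v) :
    ∃ e, IsEdge T e ∧ e.hi = v := by
  obtain ⟨a, u, ha⟩ := hv
  obtain ⟨-, hm, hat⟩ := isType2For_iff.1 ha
  obtain ⟨c, hc⟩ := hat.exists_followedBy hm
  obtain ⟨e, he, hhi, -⟩ := LCDAWG.exists_edge (.inr ⟨a, u, ha⟩) hat
    (infix_iff_begPos.2 (hc.begPos_eq ▸ infix_iff_begPos.1 hat.isInfix))
  exact ⟨e, he, hhi⟩

/-! ### Suffix links -/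

/-- `a :: s` is the shortest string of the position `v`, and `s` is right-maximal. -/
structure HeadAt (T : List α) (v : Pos α) (a : α) (s : List α) : Prop where
  at_cons : At T v (a :: s)
  rMax : RMax T s
  ne : endPos T (a :: s) ≠ endPos T s

/-- Strings of one position share their ending positions and are suffix-comparable. If one of the
two were a proper suffix of the other, `a :: s` say, it would be a suffix of `s`, squeezing the ends
of `s` to those of `a :: s`. -/
theorem HeadAt.eq {T : List α} {v : Pos α} {a b : α} {s s' : List α} (h : HeadAt T v a s)
    (h' : HeadAt T v b s') : s = s' := by
  have key : ∀ {a b : α} {s s' : List α}, HeadAt T v a s → HeadAt T v b s' →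
      b :: s' <:+ a :: s → s' = s := by
    intro a b s s' h h' hs
    rcases List.suffix_cons_iff.1 hs with heq | hs
    · simpa using (List.cons.inj heq).2
    · refine absurd ?_ h.ne
      refine (endPos_subset_of_suffix (List.suffix_cons a s)).antisymm ?_
      rw [h.at_cons.endPos_eq h'.at_cons]
      exact endPos_subset_of_suffix hs
  obtain ⟨j, hj⟩ := infix_iff_endPos.1 h.at_cons.isInfix
  rcases suffix_total hj (h.at_cons.endPos_eq h'.at_cons ▸ hj) with hs | hs
  · exact (key h h' hs).symm
  · exact key h' h hs

/-- Both kinds of suffix link delete the first letter of the shortest string of the node, which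
permits a uniform treatment from here on. -/
theorem IsSlink.exists_headAt {T : List α} {v x : Pos α} (h : IsSlink T v x) :
    ∃ a s, HeadAt T v a s ∧ x = ⟨classR T s, []⟩ := by
  rcases h with ⟨h1, y, ⟨hyv, hymax⟩, s, ⟨⟨hsy, hsv⟩, hsmax⟩, rfl⟩ | ⟨a, u, h, rfl⟩
  · obtain ⟨z, hz, rfl⟩ := isType1_iff.1 h1
    have hyv : endPos T y = endPos T z := hyv
    have hne : s ≠ y := by
      rintro rfl
      exact hsv hyv
    obtain ⟨t, rfl⟩ := hsy
    obtain ⟨t, a, rfl⟩ : ∃ t' a, t = t' ++ [a] := by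
      rcases List.eq_nil_or_concat t with rfl | ⟨t', a, ht⟩
      · simp at hne
      · exact ⟨t', a, by simpa using ht⟩
    -- `s` is the longest suffix outside the class, so the suffix one letter longer lies inside.
    have has : a :: s ∈ classR T z := by
      by_contra hns
      have := hsmax (a :: s) ⟨⟨t, by simp⟩, hns⟩
      simp at this
    have has : endPos T (a :: s) = endPos T z := has
    have hm : RMax T (a :: s) := (RMax.congr has).2 hz
    refine ⟨a, s, ⟨?_, hm.of_suffix (List.suffix_cons a s), fun h => hsv ?_⟩, rfl⟩
    · have := hm.at
      rwa [classR_eq_iff.2 has] at this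
    · exact h.symm.trans has
  · obtain ⟨hu, hm, hat⟩ := isType2For_iff.1 h
    exact ⟨a, u, ⟨hat, hu.1, fun h => hm ((RMax.congr h).2 hu.1)⟩, rfl⟩

theorem IsSlink.unique {T : List α} {v x x' : Pos α} (h : IsSlink T v x) (h' : IsSlink T v x') :
    x = x' := by
  obtain ⟨a, s, hs, rfl⟩ := h.exists_headAt
  obtain ⟨b, s', hs', rfl⟩ := h'.exists_headAt
  rw [hs.eq hs']

theorem exists_isLongest_class {T y : List α} (h : y <:+: T) : ∃ x, IsLongest (classR T y) x := by
  refine exists_isLongest ⟨y, rfl⟩ T.length fun x hx => ?_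
  have hx : endPos T x = endPos T y := hx
  exact ((infix_congr hx).2 h).length_le

theorem exists_slink {T : List α} {v : Pos α} (hv : IsNode T v) (hne : v ≠ ⟨classR T [], []⟩) :
    ∃ x, IsSlink T v x := by
  rcases hv with h1 | ⟨a, u, h⟩
  · obtain ⟨z, hz, rfl⟩ := isType1_iff.1 h1
    obtain ⟨x, hx⟩ := exists_isLongest_class hz.1
    obtain ⟨s, hs⟩ := exists_isLongest (S := {y | y <:+ x ∧ y ∉ classR T z})
      ⟨[], List.nil_suffix, fun h => hne (by rw [← classR_eq_iff.2 h])⟩ x.length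
      fun y hy => hy.1.length_le
    exact ⟨_, .inl ⟨h1, x, hx, s, hs, rfl⟩⟩
  · exact ⟨_, .inr ⟨a, u, h, rfl⟩⟩

theorem isValue_nil (T : List α) : IsValue T [] := by
  refine ⟨rMax_nil T, rfl, fun z hz => ?_⟩
  have h0 : (0 : ℕ) ∈ endPos T [] := ⟨Nat.zero_le _, List.nil_suffix⟩
  have hz : endPos T z = endPos T [] := hz
  exact length_le_of_mem_endPos (hz ▸ h0)

/-- The empty string is a value, so after one letter from the source there is always a node: of type
2 if the letter is not right-maximal. -/
theorem IsEdge.slen_of_source {T : List α} {e : Edge α} (he : IsEdge T e)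
    (hs : e.hi = ⟨classR T [], []⟩) : e.slen < 2 := by
  by_contra! hlen
  obtain ⟨c, r, hc⟩ := he.exists_lab_eq
  have hr : r ≠ [] := by
    rintro rfl
    simp [Edge.slen, hc] at hlen
  have hat : At T e.hi [] := hs ▸ (rMax_nil T).at
  have hp : [c] <+: e.lab := by simp [hc]
  have hpne : [c] ≠ e.lab := by simpa [hc, eq_comm] using hr
  have hnm : ¬ RMax T [c] := by simpa using he.not_rMax hat (by simp) hp hpne
  refine he.2.2.2.2 [c] (by simp) hp hpne (.inr ⟨c, [], isType2For_iff.2 ⟨isValue_nil T, hnm, ?_⟩⟩)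
  refine ⟨by simpa using he.infix_first hat hc, [], rMax_nil T, by simp [hs], by simp [hs], ?_⟩
  intro p hp' hpp
  have : p = [c] := by
    simp only [hs, List.nil_append] at hpp
    refine hpp.eq_of_length (le_antisymm hpp.length_le ?_)
    simpa [Nat.one_le_iff_ne_zero] using hp'
  simpa [this] using hnm

/-- Along an edge that leaves the position of `a :: s`, the string `s` is read to its next
right-maximal extension. -/
theorem IsEdge.nextR_of_headAt {T : List α} {e : Edge α} {a : α} {s : List α} (he : IsEdge T e)
    (h : HeadAt T e.hi a s) : NextR T s e.lab := by
  obtain ⟨hlo, r, hr, hpr, h1, hbase⟩ := he.spec h.at_cons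
  refine ⟨he.2.2.1, ?_, fun p hp hpe hne hm => ?_⟩
  · by_cases hlab : e.lab = r
    · subst hlab
      exact hr.rMax.of_suffix ((List.suffix_cons a _))
    · obtain ⟨b, u, h2⟩ := he.nodes.2.resolve_left fun h => hlab (h1.1 h)
      obtain ⟨hu, hnm, hat⟩ := isType2For_iff.1 h2
      have heq := hlo.endPos_eq hat
      obtain ⟨j, hj⟩ := infix_iff_endPos.1 hlo.isInfix
      rcases suffix_total hj (heq ▸ hj) with hs | hs
      · rw [List.cons_append] at hs
        rcases List.suffix_cons_iff.1 hs with hs | hs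
        · rw [← (List.cons.inj hs).2]
          exact hu.1
        -- Here `b u` is a suffix of `s lab(e)`. Cancelling the label gives a string of `e.hi` that
        -- is a suffix of `s`, against `a s` being the shortest one.
        · exfalso
          obtain ⟨z, hz, hb, hw, hmin⟩ := hat.exists_base
          obtain ⟨z', hz', hb', hw', hmin'⟩ := h.at_cons.exists_base
          rw [hbase hlab] at hb hw
          have hzz := classR_eq_iff.1 (hb.symm.trans hb')
          have hw2 : b :: u = (z ++ e.hi.off) ++ e.lab := by simpa using hw
          rw [hw2] at hs
          have hs' : z ++ e.hi.off <:+ s := by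
            obtain ⟨t, ht⟩ := hs
            rw [← List.append_assoc] at ht
            exact ⟨t, List.append_cancel_right ht⟩
          refine h.ne ((endPos_subset_of_suffix (List.suffix_cons a s)).antisymm ?_)
          rw [hw', ← endPos_append_eq_of_eq hzz e.hi.off]
          exact endPos_subset_of_suffix hs'
      · rw [List.cons_append] at hs
        rcases List.suffix_cons_iff.1 hs with hs | hs
        · rw [(List.cons.inj hs).2]
          exact hu.1
        -- Here `a s lab(e)` is a suffix of `u`, so every end of `u` is an end of `b u`, which would
        -- make `b u` right-maximal.
        · refine absurd (hu.1.of_subset ?_) hnm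
          rw [← heq]
          exact endPos_subset_of_suffix hs
  · have hinf : a :: s ++ p <:+: T :=
      ((List.prefix_append_right_inj _).2 hpe).isInfix.trans hlo.isInfix
    have hnot : ∀ q, q ≠ [] → q <+: p → ¬ RMax T (a :: s ++ q) := fun q hq hqp =>
      he.not_rMax h.at_cons hq (hqp.trans hpe) (by
        rintro rfl
        exact hne (hpe.eq_of_length (le_antisymm hpe.length_le hqp.length_le)))
    -- A type-2 node for `a s p` would lie inside `e`. It remains to see that `s p` is a value: a
    -- longer `y` with the same ends has `a s p` as a suffix, which makes `a s p` right-maximal.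
    refine he.2.2.2.2 p hp hpe hne (.inr ⟨a, s ++ p, isType2For_iff.2 ⟨⟨hm, rfl, fun y hy => ?_⟩,
      hnot p hp List.prefix_rfl, h.at_cons.append hinf hnot⟩⟩)
    have hy : endPos T y = endPos T (s ++ p) := hy
    by_contra! hlt
    obtain ⟨j, hj⟩ := infix_iff_endPos.1 hinf
    have hsub : endPos T (a :: s ++ p) ⊆ endPos T (s ++ p) :=
      endPos_subset_of_suffix (List.suffix_cons a _)
    have hsuf := suffix_of_mem_endPos (hy ▸ hsub hj) hj (by simpa using hlt)
    refine hnot p hp List.prefix_rfl (hm.of_subset ?_)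
    rw [← hy]
    exact endPos_subset_of_suffix hsuf

/-- The number of occurrences of the strings of a position. -/
noncomputable def posOcc (T : List α) (v : Pos α) : ℕ := sSup {n | ∃ w, At T v w ∧ n = occ T w}

theorem At.posOcc_eq {T w : List α} {v : Pos α} (h : At T v w) : posOcc T v = occ T w := by
  have : {n | ∃ w, At T v w ∧ n = occ T w} = {occ T w} := by
    ext n
    constructor
    · rintro ⟨w', h', rfl⟩
      simp [occ_eq_ncard_endPos, h'.endPos_eq h]
    · rintro rfl
      exact ⟨w, h, rfl⟩
  rw [posOcc, this, csSup_singleton]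

theorem occ_le (T w : List α) : occ T w ≤ T.length + 1 := by
  have h : begPos T w ⊆ Set.Iic T.length := fun i hi => hi.1
  refine (Set.ncard_le_ncard h (Set.finite_Iic _)).trans ?_
  rw [← Finset.coe_Iic, Set.ncard_coe_finset, Nat.card_Iic]

/-- The termination measure: deleting the first letter of the shortest string of a node gains
occurrences, and their number is bounded. -/
theorem IsSlink.posOcc_lt {T : List α} {v x : Pos α} (h : IsSlink T v x) :
    posOcc T v < posOcc T x ∧ posOcc T x ≤ T.length + 1 := by
  obtain ⟨a, s, hs, rfl⟩ := h.exists_headAt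
  rw [hs.at_cons.posOcc_eq, hs.rMax.at.posOcc_eq]
  refine ⟨?_, occ_le T s⟩
  rw [occ_eq_ncard_endPos, occ_eq_ncard_endPos]
  exact Set.ncard_lt_ncard ((endPos_subset_of_suffix (List.suffix_cons a s)).ssubset_of_ne hs.ne)
    (finite_endPos T s)

/-! ### Jump links -/

/-- The edge suffix link of an edge is a chain of pieces of a single edge of `CDAWG(T)`. -/
theorem IsEdge.exists_esuf {T : List α} {e : Edge α} (he : IsEdge T e) (hlen : 2 ≤ e.slen) :
    ∃ e₁ p, IsESuf T e (e₁ :: p) ∧ TypeChain T (e₁ :: p) := by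
  obtain ⟨x, hx⟩ := exists_slink he.nodes.1 fun h => by
    have := he.slen_of_source h
    omega
  obtain ⟨a, s, hs, rfl⟩ := hx.exists_headAt
  obtain ⟨e₁, p, y, hp, hc, hl⟩ := exists_typeChain (.inl hs.rMax.isType1) hs.rMax.at
    (he.nextR_of_headAt hs)
  exact ⟨e₁, p, ⟨_, y, hx, hp, hl⟩, hc⟩

theorem IsESuf.unique {T : List α} {e : Edge α} {p p' : List (Edge α)} (h : IsESuf T e p)
    (h' : IsESuf T e p') : p = p' := by
  obtain ⟨v, w, hv, hp, hl⟩ := h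
  obtain ⟨v', w', hv', hp', hl'⟩ := h'
  obtain rfl := hv.unique hv'
  exact hp.unique hp' (hl.trans hl'.symm)

theorem IsJump.unique {T : List α} {e : Edge α} {p p' : List (Edge α)} (h : IsJump T e p)
    (h' : IsJump T e p') : p = p' := by
  induction h with
  | single he hl hs _ ih =>
    cases h' with
    | single _ _ hs' h' =>
      have := hs.unique hs'
      simp only [List.cons.injEq, and_true] at this
      exact ih (this ▸ h')
    | path _ _ hs' h' =>
      rw [← hs.unique hs'] at h'
      simp at h'
  | path he hl hs hp =>
    cases h' with
    | single _ _ hs' h' =>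
      rw [hs.unique hs'] at hp
      simp at hp
    | path _ _ hs' h' => exact hs.unique hs'

theorem IsESuf.spec_head {T : List α} {e e₁ : Edge α} {p : List (Edge α)}
    (h : IsESuf T e (e₁ :: p)) : IsEdge T e₁ ∧ IsSlink T e.hi e₁.hi ∧ e₁.lab <+: e.lab := by
  obtain ⟨v, w, hv, hp, hl⟩ := h
  refine ⟨hp.1, hp.2.1 ▸ hv, pathLab p, ?_⟩
  simpa [pathLab] using hl

theorem IsESuf.slen_single {T : List α} {e e₁ : Edge α} (h : IsESuf T e [e₁]) :
    e₁.lab = e.lab := by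
  obtain ⟨v, w, hv, hp, hl⟩ := h
  simpa [pathLab] using hl

theorem IsEdge.exists_jump {T : List α} {e : Edge α} (he : IsEdge T e) (hlen : 2 ≤ e.slen) :
    ∃ p, IsJump T e p ∧ (∃ v w, IsPath T v p w) ∧ 2 ≤ p.length ∧ pathLab p = e.lab := by
  induction hn : T.length + 1 - posOcc T e.hi using Nat.strong_induction_on generalizing e with
  | _ n ih =>
    subst hn
    obtain ⟨e₁, p, hs, hc⟩ := he.exists_esuf hlen
    cases p with
    | nil =>
      obtain ⟨he₁, hsl, -⟩ := hs.spec_head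
      have hlab := hs.slen_single
      have := hsl.posOcc_lt
      obtain ⟨p, hp, hpath, hpl, hplab⟩ := ih _ (by omega) he₁ (by rwa [Edge.slen, hlab]) rfl
      exact ⟨p, .single he hlen hs hp, hpath, hpl, hplab.trans hlab⟩
    | cons e₂ p =>
      have hl : 2 ≤ (e₁ :: e₂ :: p).length := by simp
      refine ⟨_, .path he hlen hs hl, ?_, hl, ?_⟩
      · obtain ⟨v, w, -, hp, -⟩ := hs
        exact ⟨v, w, hp⟩
      · obtain ⟨v, w, -, -, hp⟩ := hs
        exact hp

/-! ### The number of edges -/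

/-- Right-maximality handles right extensions and maximal length in the class handles left ones.
Since each extension loses an occurrence, one that does occur shows that `u` occurs twice. -/
theorem IsValue.isMaximalRepeat {T u : List α} (hu : IsValue T u)
    (h : (∃ a, u ++ [a] <:+: T) ∨ ∃ a, a :: u <:+: T) : IsMaximalRepeat T u := by
  have hleft : ∀ a : α, endPos T (a :: u) ≠ endPos T u := fun a ha => by
    have := hu.2.2 (a :: u) ha
    simp at this
  have hright : ∀ a : α, begPos T (u ++ [a]) ≠ begPos T u := fun a ha =>
    hu.1.2 ⟨a, followedBy_of_begPos_subset ha.ge⟩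
  have hr : ∀ a : α, occ T (u ++ [a]) < occ T u := fun a =>
    Set.ncard_lt_ncard ((begPos_subset_of_prefix (List.prefix_append _ _)).ssubset_of_ne (hright a))
      (finite_begPos T u)
  have hl : ∀ a : α, occ T (a :: u) < occ T u := fun a => by
    rw [occ_eq_ncard_endPos, occ_eq_ncard_endPos]
    exact Set.ncard_lt_ncard
      ((endPos_subset_of_suffix (List.suffix_cons _ _)).ssubset_of_ne (hleft a)) (finite_endPos T u)
  have hpos : ∀ {x : List α}, x <:+: T → 0 < occ T x := fun hx =>
    (Set.ncard_pos (finite_begPos T _)).2 (infix_iff_begPos.1 hx)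
  refine ⟨?_, fun a _ => hr a, fun a _ => hl a⟩
  rcases h with ⟨a, ha⟩ | ⟨a, ha⟩
  · exact lt_of_le_of_lt (hpos ha) (hr a)
  · exact lt_of_le_of_lt (hpos ha) (hl a)

theorem finite_infixes (T : List α) : {y | y <:+: T}.Finite :=
  (List.finite_toSet T.sublists).subset fun _ hy => List.mem_sublists.2 hy.sublist

theorem finite_rightExtensions (T : List α) : (rightExtensions T).Finite :=
  (finite_infixes T).subset (by rintro _ ⟨w, a, -, -, h⟩; exact h)

theorem finite_leftExtensions (T : List α) : (leftExtensions T).Finite :=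
  (finite_infixes T).subset (by rintro _ ⟨w, a, -, -, h⟩; exact h)

theorem IsEdge.exists_rightExtension {T : List α} {e : Edge α} (he : IsEdge T e)
    (h : IsType1 T e.hi) : ∃ y ∈ rightExtensions T, ∃ u c r, y = u ++ [c] ∧ e.lab = c :: r ∧
      e.hi = ⟨classR T u, []⟩ := by
  obtain ⟨z, hz, hzhi⟩ := isType1_iff.1 h
  obtain ⟨u, hu⟩ := exists_isLongest_class hz.1
  have heq : endPos T u = endPos T z := hu.1
  have hm := (RMax.congr heq).2 hz
  rw [← classR_eq_iff.2 heq] at hzhi hu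
  obtain ⟨c, r, hc⟩ := he.exists_lab_eq
  have hinf := he.infix_first (hzhi ▸ hm.at) hc
  exact ⟨_, ⟨u, c, IsValue.isMaximalRepeat ⟨hm, hu⟩ (.inl ⟨c, hinf⟩), rfl, hinf⟩, u, c, r, rfl, hc,
    hzhi⟩

/-- An edge from the type-1 node with value `u` is charged to `u c`, with `c` its first letter; the
only edge from a type-2 node is charged to a string `a u` that the node represents. -/
theorem card_edges_le (T : List α) :
    Finite {e : Edge α // IsEdge T e} ∧ Nat.card {e : Edge α // IsEdge T e} ≤ numExtensions T := by
  classical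
  have := (finite_rightExtensions T).to_subtype
  have := (finite_leftExtensions T).to_subtype
  have hex : ∀ e : {e : Edge α // IsEdge T e}, ∃ y : rightExtensions T ⊕ leftExtensions T,
      (∀ x, y = .inl x → ∃ u c r, x.1 = u ++ [c] ∧ e.1.lab = c :: r ∧
        e.1.hi = ⟨classR T u, []⟩) ∧
      ∀ x, y = .inr x → IsType2 T e.1.hi ∧ At T e.1.hi x.1 := by
    rintro ⟨e, he⟩
    rcases he.nodes.1 with h | ⟨a, u, h⟩
    · obtain ⟨y, hy, h⟩ := he.exists_rightExtension h
      exact ⟨.inl ⟨y, hy⟩, by rintro _ ⟨⟩; exact h, by rintro _ ⟨⟩⟩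
    · obtain ⟨hu, hm, hat⟩ := isType2For_iff.1 h
      refine ⟨.inr ⟨a :: u, u, a, hu.isMaximalRepeat (.inr ⟨a, hat.isInfix⟩), rfl, hat.isInfix⟩,
        by rintro _ ⟨⟩, ?_⟩
      rintro _ ⟨⟩
      exact ⟨⟨a, u, h⟩, hat⟩
  choose f hf1 hf2 using hex
  have hinj : Function.Injective f := by
    rintro ⟨e, he⟩ ⟨e', he'⟩ h
    apply Subtype.ext
    rcases hy : f ⟨e, he⟩ with x | x
    · obtain ⟨u, c, r, hx, hlab, hhi⟩ := hf1 _ x hy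
      obtain ⟨u', c', r', hx', hlab', hhi'⟩ := hf1 _ x (h ▸ hy)
      obtain ⟨rfl, hc⟩ := List.append_inj' (hx.symm.trans hx') rfl
      obtain rfl : c = c' := by simpa using hc
      exact he.unique he' (hhi.trans hhi'.symm) hlab hlab'
    · obtain ⟨h2, hat⟩ := hf2 _ x hy
      obtain ⟨-, hat'⟩ := hf2 _ x (h ▸ hy)
      exact h2.edge_unique he he' rfl (hat'.unique hat)
  refine ⟨Finite.of_injective f hinj, (Nat.card_le_card_of_injective f hinj).trans ?_⟩
  rw [Nat.card_sum, Nat.card_coe_set_eq, Nat.card_coe_set_eq, numExtensions]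

theorem exists_edge_of_ne_nil {T : List α} (hT : T ≠ []) : ∃ e, IsEdge T e := by
  obtain ⟨c, r, rfl⟩ := List.exists_cons_of_ne_nil hT
  obtain ⟨e, he, -⟩ := exists_edge (T := c :: r) (.inl (rMax_nil _).isType1) (rMax_nil _).at
    (c := c) ⟨[], r, by simp⟩
  exact ⟨e, he⟩

/-! ### Weakest preconditions with running times -/

/-- Started in the word state `s`, the program halts after `t` steps in a word state `s'` with
`Q t s'`. -/
def WP (cmp : ℕ → ℕ → Prop) (w : ℕ) (p : Prog) (Q : ℕ → State → Prop) (s : State) : Prop :=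
  s.IsWordState w → ∃ t s', Exec cmp w p s t s' ∧ s'.IsWordState w ∧ Q t s'

/-- The state after writing a register. -/
def State.setReg (s : State) (d n : ℕ) : State := ⟨Function.update s.reg d n, s.mem⟩

/-- The state after writing a memory cell. -/
def State.setMem (s : State) (k i n : ℕ) : State :=
  ⟨s.reg, Function.update s.mem k (Function.update (s.mem k) i n)⟩

@[simp] theorem State.setReg_mem (s : State) (d n : ℕ) : (s.setReg d n).mem = s.mem := rfl

@[simp] theorem State.setMem_reg (s : State) (k i n : ℕ) : (s.setMem k i n).reg = s.reg := rfl

theorem State.setReg_reg (s : State) (d n r : ℕ) :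
    (s.setReg d n).reg r = if r = d then n else s.reg r := by
  simp [State.setReg, Function.update_apply]

theorem State.setMem_mem (s : State) (k i n l j : ℕ) :
    (s.setMem k i n).mem l j = if l = k ∧ j = i then n else s.mem l j := by
  simp only [State.setMem, Function.update_apply]
  split_ifs <;> simp_all

theorem State.setMem_mem_of_ne (s : State) {k l : ℕ} (i n : ℕ) (h : l ≠ k) :
    (s.setMem k i n).mem l = s.mem l := by
  simp [State.setMem, h]

variable {cmp : ℕ → ℕ → Prop} {w : ℕ} {Q : ℕ → State → Prop} {s : State}

theorem WP.mono {p : Prog} {Q' : ℕ → State → Prop} (h : WP cmp w p Q s)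
    (hQ : ∀ t s', Q t s' → Q' t s') : WP cmp w p Q' s := fun hs =>
  let ⟨t, s', h1, h2, h3⟩ := h hs
  ⟨t, s', h1, h2, hQ t s' h3⟩

theorem WP.set {d : ℕ} {o : Op} (ho : s.IsWordState w → o.val s < 2 ^ w)
    (hQ : Q 1 (s.setReg d (o.val s))) : WP cmp w (.set d o) Q s := fun hs =>
  ⟨1, _, .set (ho hs), ⟨fun r => by
    change (s.setReg d (o.val s)).reg r < _
    rw [State.setReg_reg]
    split_ifs
    exacts [ho hs, hs.1 r], hs.2⟩, hQ⟩

theorem WP.const {d n : ℕ} (h : n < 2 ^ w) (hQ : Q 1 (s.setReg d n)) :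
    WP cmp w (.set d (.const n)) Q s := .set (fun _ => h) hQ

theorem WP.copy {d a : ℕ} (hQ : Q 1 (s.setReg d (s.reg a))) :
    WP cmp w (.set d (.copy a)) Q s := .set (fun hs => hs.1 a) hQ

theorem WP.add {d a b : ℕ} (h : s.reg a + s.reg b < 2 ^ w)
    (hQ : Q 1 (s.setReg d (s.reg a + s.reg b))) : WP cmp w (.set d (.add a b)) Q s :=
  .set (fun _ => h) hQ

theorem WP.half {d a : ℕ} (hQ : Q 1 (s.setReg d (s.reg a / 2))) :
    WP cmp w (.set d (.half a)) Q s :=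
  .set (fun hs => lt_of_le_of_lt (Nat.div_le_self _ _) (hs.1 a)) hQ

theorem WP.load {d k a : ℕ} (hQ : Q 1 (s.setReg d (s.mem k (s.reg a)))) :
    WP cmp w (.set d (.load k a)) Q s := .set (fun hs => hs.2 k _) hQ

theorem WP.store {k a b : ℕ} (hQ : Q 1 (s.setMem k (s.reg a) (s.reg b))) :
    WP cmp w (.store k a b) Q s := fun hs =>
  ⟨1, _, .store, ⟨hs.1, fun l j => by
    change (s.setMem k (s.reg a) (s.reg b)).mem l j < _
    rw [State.setMem_mem]
    split_ifs
    exacts [hs.1 b, hs.2 l j]⟩, hQ⟩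

theorem WP.seq {p q : Prog}
    (h : WP cmp w p (fun t s' => WP cmp w q (fun t' s'' => Q (t + t') s'') s') s) :
    WP cmp w (.seq p q) Q s := fun hs =>
  let ⟨t, _, h1, h2, h3⟩ := h hs
  let ⟨t', s'', h4, h5, h6⟩ := h3 h2
  ⟨t + t', s'', .seq h1 h4, h5, h6⟩

theorem WP.ite {c : Test} {p q : Prog}
    (hp : c.Holds cmp s → WP cmp w p (fun t s' => Q (t + 1) s') s)
    (hq : ¬ c.Holds cmp s → WP cmp w q (fun t s' => Q (t + 1) s') s) :
    WP cmp w (.ite c p q) Q s := fun hs => by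
  by_cases h : c.Holds cmp s
  · obtain ⟨t, s', h1, h2, h3⟩ := hp h hs
    exact ⟨t + 1, s', .ite_true h h1, h2, h3⟩
  · obtain ⟨t, s', h1, h2, h3⟩ := hq h hs
    exact ⟨t + 1, s', .ite_false h h1, h2, h3⟩

/-- A loop whose invariant `I n` carries a time credit `n` that pays for every iteration. -/
theorem WP.while {c : Test} {p : Prog} (I : ℕ → State → Prop) {n : ℕ} (h0 : I n s)
    (hI : ∀ n s, I n s → c.Holds cmp s →
      WP cmp w p (fun t s' => ∃ n', I n' s' ∧ t + 1 + n' ≤ n) s) :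
    WP cmp w (.while c p)
      (fun t s' => ∃ n', I n' s' ∧ ¬ c.Holds cmp s' ∧ t + n' ≤ n + 1) s := by
  induction n using Nat.strong_induction_on generalizing s with
  | _ n ih =>
    intro hs
    by_cases h : c.Holds cmp s
    · obtain ⟨t, s', h1, h2, n', h3, h4⟩ := hI n s h0 h hs
      obtain ⟨t', s'', h5, h6, n'', h7, h8, h9⟩ := ih n' (by omega) h3 h2
      exact ⟨t + t' + 1, s'', .while_true h h1 h5, h6, n'', h7, h8, by omega⟩
    · exact ⟨1, s, .while_false h, hs, n, h0, h, by omega⟩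

/-! ### The program -/

namespace Jump

/-- Writes the cell of the edge whose number is in register 4 and clears its jump link. -/
def cellBody : Prog :=
  .seq (.set 5 (.load 5 4)) <| .seq (.set 6 (.load 0 5)) <| .seq (.set 7 (.add 4 2)) <|
  .seq (.store 8 7 4) <|
  .seq (.ite (.eq 6 3) (.seq (.set 8 (.load 2 5)) (.set 8 (.add 8 2))) (.set 8 (.const 0))) <|
  .seq (.store 9 7 8) <| .seq (.store 7 4 11) (.set 4 (.copy 7))

/-- One step of the binary search in the interval given by registers 7 and 8 for the first
character of the edge in register 4. -/
def searchBody : Prog :=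
  .seq (.set 9 (.add 7 8)) <| .seq (.set 9 (.half 9)) <|
  .seq (.ite (.chr 4 9) (.set 8 (.copy 9)) (.set 7 (.copy 9))) (.set 9 (.add 7 2))

/-- Finds the first edge of the edge suffix link of the edge in register 4. -/
def linkEdge : Prog :=
  .seq (.set 6 (.load 4 4)) <| .seq (.set 6 (.load 1 6)) <| .seq (.set 7 (.load 2 6)) <|
  .seq (.set 8 (.load 3 6)) <| .seq (.set 9 (.add 7 2)) <|
  .seq (.while (.lt 9 8) searchBody) <|
  .seq (.store 10 4 7) <| .seq (.set 5 (.load 9 9)) <|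
  -- Register 9 is the address of the cell of the edge found, its number plus one. If that cell has
  -- no successor, the edge suffix link is a single edge and the jump link stays 0; the first branch
  -- changes nothing.
  .ite (.eq 5 11) (.set 5 (.copy 11)) (.store 7 4 9)

/-- Follows the edges in array 10 to an edge with a known jump link and copies this jump link to
all edges passed. -/
def resolveEdge : Prog :=
  .seq (.set 6 (.copy 4)) <| .seq (.set 7 (.load 7 6)) <|
  .seq (.while (.eq 7 11) (.seq (.set 6 (.load 10 6)) (.set 7 (.load 7 6)))) <|
  .seq (.set 6 (.copy 4)) <| .seq (.set 8 (.load 7 6)) <|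
  .while (.eq 8 11) (.seq (.store 7 6 7) <| .seq (.set 6 (.load 10 6)) (.set 8 (.load 7 6)))

/-- Runs `p` for all edges with string length at least 2. -/
def forLong (p : Prog) : Prog :=
  .seq (.set 4 (.copy 11)) <| .while (.lt 4 1) <|
    .seq (.set 5 (.load 6 4)) <| .seq (.ite (.lt 5 3) (.set 5 (.copy 11)) p) (.set 4 (.add 4 2))

/-- The computation of all jump links. -/
def program : Prog :=
  -- Registers 2, 3 and 11 keep the constants 1, 2 and 0 throughout.
  .seq (.set 2 (.const 1)) <| .seq (.set 3 (.const 2)) <| .seq (.set 11 (.const 0)) <|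
  .seq (.set 4 (.copy 11)) <| .seq (.while (.lt 4 1) cellBody) <|
  .seq (forLong linkEdge) (forLong resolveEdge)

end Jump

/-! ### The invariants of the program -/

section Layout

variable {α : Type u} [LinearOrder α] {T : List α} (G : Layout T)

/-- The stored structure together with the constants used by the program. -/
structure Layout.Env (s : State) : Prop where
  stored : G.Stored s
  one : s.reg 2 = 1
  two : s.reg 3 = 2
  zero : s.reg 11 = 0

variable {G}

theorem Layout.Stored.of_eq {s s' : State} (h : G.Stored s) (h0 : s'.reg 0 = s.reg 0)
    (h1 : s'.reg 1 = s.reg 1) (hm : ∀ k ≤ 6, s'.mem k = s.mem k) : G.Stored s' where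
  numNodes := h0.trans h.numNodes
  numEdges := h1.trans h.numEdges
  type1 v hv := by rw [hm 0 (by norm_num)]; exact h.type1 v hv
  type2 v hv := by rw [hm 0 (by norm_num)]; exact h.type2 v hv
  slink v v' hv := by rw [hm 1 (by norm_num)]; exact h.slink v v' hv
  out v i := by rw [hm 2 (by norm_num), hm 3 (by norm_num)]; exact h.out v i
  hi i v hv := by rw [hm 4 (by norm_num)]; exact h.hi i v hv
  lo i v hv := by rw [hm 5 (by norm_num)]; exact h.lo i v hv
  slen i := by rw [hm 6 (by norm_num)]; exact h.slen i

theorem Layout.Env.setReg {s : State} (h : G.Env s) {d : ℕ} (n : ℕ) (hd : 4 ≤ d ∧ d ≠ 11) :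
    G.Env (s.setReg d n) := by
  have hr : ∀ r, r ≠ d → (s.setReg d n).reg r = s.reg r := fun r hr => by
    rw [State.setReg_reg, if_neg hr]
  refine ⟨h.stored.of_eq (hr _ (by omega)) (hr _ (by omega)) fun _ _ => rfl, ?_, ?_, ?_⟩
  · rw [hr _ (by omega), h.one]
  · rw [hr _ (by omega), h.two]
  · rw [hr _ (by omega), h.zero]

theorem Layout.Env.setMem {s : State} (h : G.Env s) {k : ℕ} (i n : ℕ) (hk : 7 ≤ k) :
    G.Env (s.setMem k i n) :=
  ⟨h.stored.of_eq rfl rfl fun l hl => s.setMem_mem_of_ne i n (by omega), h.one, h.two, h.zero⟩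

theorem Layout.exists_node {v : Pos α} (hv : IsNode T v) : ∃ i, (G.node i).1 = v :=
  ⟨G.node.symm ⟨v, hv⟩, by simp⟩

theorem Layout.exists_edge {e : Edge α} (he : IsEdge T e) : ∃ i, (G.edge i).1 = e :=
  ⟨G.edge.symm ⟨e, he⟩, by simp⟩

theorem Layout.edge_injective {i j : Fin G.M} (h : (G.edge i).1 = (G.edge j).1) : i = j :=
  G.edge.injective (Subtype.ext h)

theorem Layout.Stored.exists_hi {s : State} (h : G.Stored s) (i : Fin G.M) :
    ∃ v : Fin G.N, (G.node v).1 = (G.edge i).1.hi ∧ s.mem 4 i = v := by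
  obtain ⟨v, hv⟩ := G.exists_node (G.edge i).2.nodes.1
  exact ⟨v, hv, h.hi i v hv.symm⟩

theorem Layout.Stored.exists_lo {s : State} (h : G.Stored s) (i : Fin G.M) :
    ∃ v : Fin G.N, (G.node v).1 = (G.edge i).1.lo ∧ s.mem 5 i = v := by
  obtain ⟨v, hv⟩ := G.exists_node (G.edge i).2.nodes.2
  exact ⟨v, hv, h.lo i v hv.symm⟩

variable (G)

/-- `a` is the address of the rest of the chain after the edge `i`. -/
def Layout.NextAddr (i : Fin G.M) (a : ℕ) : Prop :=
  IsType1 T (G.edge i).1.lo ∧ a = 0 ∨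
    IsType2 T (G.edge i).1.lo ∧ ∃ k : Fin G.M, (G.edge k).1.hi = (G.edge i).1.lo ∧ a = k + 1

/-- The cells of the first `n` edges are written. -/
def Layout.Cells (n : ℕ) (m : ℕ → ℕ → ℕ) : Prop :=
  ∀ i : Fin G.M, (i : ℕ) < n → m 8 (i + 1) = i ∧ G.NextAddr i (m 9 (i + 1))

/-- `a` is the address of the jump link of the edge `i`. -/
def Layout.JumpAddr (i : Fin G.M) (a : ℕ) : Prop :=
  ∃ k : Fin G.M, a = k + 1 ∧ ∃ p, IsJump T (G.edge i).1 ((G.edge k).1 :: p) ∧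
    TypeChain T ((G.edge k).1 :: p)

/-- The jump link of the edge `i` is known, or is that of the edge in array 10. -/
def Layout.Linked (m : ℕ → ℕ → ℕ) (i : Fin G.M) : Prop :=
  m 7 i ≠ 0 ∧ G.JumpAddr i (m 7 i) ∨
    m 7 i = 0 ∧ ∃ k : Fin G.M, m 10 i = k ∧ IsESuf T (G.edge i).1 [(G.edge k).1]

variable {G}

theorem Layout.Stored.two_iff {s : State} (h : G.Stored s) (i : Fin G.M) :
    s.mem 0 (s.mem 5 i) = 2 ↔ IsType2 T (G.edge i).1.lo := by
  obtain ⟨v, hv, hm⟩ := h.exists_lo i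
  rw [hm]
  refine ⟨fun h2 => ?_, fun h2 => h.type2 v (hv ▸ h2)⟩
  refine (G.edge i).2.nodes.2.resolve_left fun h1 => ?_
  rw [h.type1 v (hv ▸ h1)] at h2
  norm_num at h2

theorem Layout.Stored.nextAddr_two {s : State} (h : G.Stored s) (i : Fin G.M)
    (h2 : s.mem 0 (s.mem 5 i) = 2) :
    s.mem 2 (s.mem 5 i) < G.M ∧ G.NextAddr i (s.mem 2 (s.mem 5 i) + 1) := by
  have ht := (h.two_iff i).1 h2
  obtain ⟨v, hv, hm⟩ := h.exists_lo i
  obtain ⟨e, he, hhi⟩ := ht.exists_edge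
  obtain ⟨k, rfl⟩ := G.exists_edge he
  have hk := (h.out v k).2 ⟨k.2, hhi.trans hv.symm⟩
  obtain ⟨hlt, hout⟩ := (h.out v (s.mem 2 v)).1 ⟨le_rfl, by omega⟩
  rw [hm]
  exact ⟨hlt, .inr ⟨ht, ⟨_, hlt⟩, hout.trans hv, rfl⟩⟩

theorem Layout.Stored.nextAddr_one {s : State} (h : G.Stored s) (i : Fin G.M)
    (h2 : s.mem 0 (s.mem 5 i) ≠ 2) : G.NextAddr i 0 :=
  .inl ⟨(G.edge i).2.nodes.2.resolve_right fun ht => h2 ((h.two_iff i).2 ht), rfl⟩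

/-- The successor of a cell depends on its edge alone, because the chain continues uniquely at
type-2 nodes and stops at type 1. Hence all chains share the cells. -/
theorem Layout.Cells.listAt {s : State} (h : G.Cells G.M s.mem) {p : List (Edge α)}
    (hp : TypeChain T p) : ∀ (i : Fin G.M) (q : List (Edge α)), p = (G.edge i).1 :: q →
    ∃ l : List (Fin G.M), l.map (fun j => (G.edge j).1) = p ∧
      ListAt s (i + 1) (l.map (fun j => (j : ℕ))) := by
  induction hp with
  | @single e he h1 =>
    intro i q hq
    obtain ⟨rfl, rfl⟩ := List.cons.inj hq
    obtain ⟨h8, h9⟩ := h i i.2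
    refine ⟨[i], rfl, ?_⟩
    have h9 : s.mem 9 (i + 1) = 0 := by
      rcases h9 with h9 | h9
      · exact h9.2
      · exact absurd h1.off_eq h9.1.off_ne
    have := ListAt.cons (s := s) (a := i + 1) (l := []) (by omega) (h9 ▸ .nil)
    rwa [h8] at this
  | @cons e e' p he h2 hhi hc ih =>
    intro i q hq
    obtain ⟨rfl, rfl⟩ := List.cons.inj hq
    obtain ⟨h8, h9⟩ := h i i.2
    rcases h9 with h9 | ⟨-, k, hk, h9⟩
    · exact absurd h9.1.off_eq h2.off_ne
    · have he' : IsEdge T e' := by cases hc <;> assumption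
      obtain ⟨l, hl, hat⟩ := ih k p (by rw [h2.edge_unique he' (G.edge k).2 hhi hk])
      refine ⟨i :: l, by simp [hl], ?_⟩
      have := ListAt.cons (s := s) (a := i + 1) (by omega) (h9 ▸ hat)
      rwa [h8] at this

theorem Layout.JumpAddr.ne_zero {i : Fin G.M} {a : ℕ} (h : G.JumpAddr i a) : a ≠ 0 := by
  obtain ⟨k, rfl, -⟩ := h
  omega

theorem Layout.Cells.jumpsStored {s : State} (h : G.Cells G.M s.mem)
    (hj : ∀ i : Fin G.M, 2 ≤ (G.edge i).1.slen → G.JumpAddr i (s.mem 7 i)) : G.JumpsStored s := by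
  intro i p hi hp
  obtain ⟨k, hk, q, hq, hc⟩ := hj i hi
  obtain rfl := hp.unique hq
  obtain ⟨l, hl, hat⟩ := h.listAt hc k q rfl
  exact ⟨l, hl, hk ▸ hat⟩

/-! ### Sequences of single edge suffix links -/

/-- Following `f` from `j`, the first nonzero value of `val` is `a`, found after `d` steps. -/
inductive Reach (val f : ℕ → ℕ) : ℕ → ℕ → ℕ → Prop
  | zero {j : ℕ} : val j ≠ 0 → Reach val f j 0 (val j)
  | succ {j d a : ℕ} : val j = 0 → Reach val f (f j) d a → Reach val f j (d + 1) a

theorem Reach.unique {val f : ℕ → ℕ} {j d a d' a' : ℕ} (h : Reach val f j d a)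
    (h' : Reach val f j d' a') : d = d' ∧ a = a' := by
  induction h generalizing d' with
  | zero hj =>
    cases h' with
    | zero => exact ⟨rfl, rfl⟩
    | succ hj' => exact absurd hj' hj
  | succ hj _ ih =>
    cases h' with
    | zero hj' => exact absurd hj hj'
    | succ _ h' =>
      obtain ⟨rfl, rfl⟩ := ih h'
      exact ⟨rfl, rfl⟩

/-- The walk from `k` is shorter than the one from `j`, so it never visits `j` and does not notice
the change there. -/
theorem Reach.update {val f : ℕ → ℕ} {j k d a d' a' : ℕ} (x : ℕ) (h : Reach val f k d a)
    (h' : Reach val f j d' a') (hlt : d < d') : Reach (Function.update val j x) f k d a := by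
  induction h with
  | @zero k hk =>
    have hne : k ≠ j := by
      rintro rfl
      have := (Reach.zero (f := f) hk).unique h'
      omega
    have := Reach.zero (val := Function.update val j x) (f := f) (j := k) (by simpa [hne] using hk)
    simpa [hne] using this
  | @succ k d a hk hr ih =>
    have hne : k ≠ j := by
      rintro rfl
      have := (Reach.succ hk hr).unique h'
      omega
    exact .succ (by simpa [hne] using hk) (ih (by omega))

/-- Array 10 moves the upper end along its suffix link, so occurrence counts bound the walk. -/
theorem Layout.exists_reach {m : ℕ → ℕ → ℕ}
    (h : ∀ i : Fin G.M, 2 ≤ (G.edge i).1.slen → G.Linked m i) (i : Fin G.M)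
    (hi : 2 ≤ (G.edge i).1.slen) : ∃ d a, Reach (m 7) (m 10) i d a := by
  induction hn : T.length + 1 - posOcc T (G.edge i).1.hi using Nat.strong_induction_on
    generalizing i with
  | _ n ih =>
    subst hn
    rcases h i hi with h7 | ⟨h7, k, hk, hs⟩
    · exact ⟨0, _, .zero h7.1⟩
    · have := hs.spec_head.2.1.posOcc_lt
      obtain ⟨d, a, hr⟩ := ih _ (by omega) k (by rwa [Edge.slen, hs.slen_single]) rfl
      exact ⟨d + 1, a, .succ h7 (hk ▸ hr)⟩

theorem Reach.jumpAddr {m : ℕ → ℕ → ℕ}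
    (h : ∀ i : Fin G.M, 2 ≤ (G.edge i).1.slen → G.Linked m i) {j d a : ℕ}
    (hr : Reach (m 7) (m 10) j d a) : ∀ i : Fin G.M, (i : ℕ) = j → 2 ≤ (G.edge i).1.slen →
      G.JumpAddr i a := by
  induction hr with
  | zero hj =>
    rintro i rfl hi
    exact ((h i hi).resolve_right fun h' => hj h'.1).2
  | succ hj _ ih =>
    rintro i rfl hi
    obtain ⟨-, k, hk, hs⟩ := (h i hi).resolve_left fun h' => h'.1 hj
    obtain ⟨l, rfl, p, hp, hc⟩ := ih k hk.symm (by rwa [Edge.slen, hs.slen_single])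
    exact ⟨l, rfl, p, .single (G.edge i).2 hi hs hp, hc⟩

/-! ### First characters -/

theorem FirstCharLT.asymm {e f : Edge α} (h : FirstCharLT e f) : ¬ FirstCharLT f e := by
  rintro ⟨a, b, x, y, h1, h2, hlt⟩
  obtain ⟨a', b', x', y', h1', h2', hlt'⟩ := h
  have ha := (List.cons.inj (h2.symm.trans h1')).1
  have hb := (List.cons.inj (h1.symm.trans h2')).1
  rw [← ha, ← hb] at hlt'
  exact lt_asymm hlt hlt'

theorem Layout.firstCharLT_iff {i j : Fin G.M} (h : (G.edge i).1.hi = (G.edge j).1.hi) :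
    FirstCharLT (G.edge i).1 (G.edge j).1 ↔ i < j := by
  refine ⟨fun hlt => ?_, fun hlt => G.sorted i j hlt h⟩
  by_contra! hle
  rcases hle.eq_or_lt with rfl | hlt'
  · exact hlt.asymm hlt
  · exact hlt.asymm (G.sorted j i hlt' h.symm)

theorem firstCharLT_congr {e e' f : Edge α} {c : α} {r r' : List α} (h : e.lab = c :: r)
    (h' : e'.lab = c :: r') : FirstCharLT e f ↔ FirstCharLT e' f := by
  constructor
  · rintro ⟨a, b, x, y, h1, h2, hlt⟩
    rw [h] at h1
    exact ⟨c, b, r', y, h', h2, (List.cons.inj h1).1 ▸ hlt⟩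
  · rintro ⟨a, b, x, y, h1, h2, hlt⟩
    rw [h'] at h1
    exact ⟨c, b, r, y, h, h2, (List.cons.inj h1).1 ▸ hlt⟩

/-- Edges leaving one node differ in their first letters. -/
theorem Layout.Stored.degree_le [Fintype α] {s : State} (h : G.Stored s) (v : Fin G.N) :
    s.mem 3 v - s.mem 2 v ≤ Fintype.card α := by
  classical
  have hex : ∀ i : Fin (s.mem 3 v - s.mem 2 v), ∃ c r, ∃ k : Fin G.M,
      (k : ℕ) = s.mem 2 v + i ∧ (G.edge k).1.hi = (G.node v).1 ∧ (G.edge k).1.lab = c :: r := by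
    intro i
    obtain ⟨hk, hhi⟩ := (h.out v (s.mem 2 v + i)).1 ⟨by omega, by omega⟩
    obtain ⟨c, r, hc⟩ := (G.edge ⟨_, hk⟩).2.exists_lab_eq
    exact ⟨c, r, ⟨_, hk⟩, rfl, hhi, hc⟩
  choose c r k hk hhi hc using hex
  have hinj : Function.Injective c := fun i j hij => by
    have := G.edge_injective ((G.edge (k i)).2.unique (G.edge (k j)).2 ((hhi i).trans (hhi j).symm)
      (hc i) (hij ▸ hc j))
    have h1 := hk i
    have h2 := hk j
    rw [this] at h1
    exact Fin.ext (by omega)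
  simpa using Fintype.card_le_of_injective c hinj

end Layout

/-! ### Correctness and running time of the program -/

section Layout

variable {α : Type u} [LinearOrder α] {T : List α} {G : Layout T} {w : ℕ}

namespace Jump

theorem cellBody_spec {s : State} (hs : G.Env s) (i : Fin G.M) (hi : s.reg 4 = i)
    (hw : 4 * G.M + 4 ≤ 2 ^ w) :
    WP G.cmp w cellBody (fun t s' => t ≤ 10 ∧ G.Env s' ∧ s'.reg 4 = i + 1 ∧
      ∃ a, G.NextAddr i a ∧
        ∀ k j, s'.mem k j = if k = 7 ∧ j = i then 0 else if k = 8 ∧ j = i + 1 then (i : ℕ) else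
          if k = 9 ∧ j = i + 1 then a else s.mem k j) s := by
  have h1 := hs.one
  have h2 := hs.two
  have h0 := hs.zero
  have hM := i.2
  refine .seq <| .load <| .seq <| .load <| .seq <| .add ?_ <| .seq <| .store <| .seq <|
    .ite (fun h => .seq <| .load <| .add ?_ <| .seq <| .store <| .seq <| .store <| .copy ?_)
      (fun h => .const (by omega) <| .seq <| .store <| .seq <| .store <| .copy ?_)
  · simp [State.setReg_reg]
    omega
  · simp [Test.Holds, State.setReg_reg, State.setMem_mem, hi, h1, h2] at h ⊢
    have := (hs.stored.nextAddr_two i h).1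
    omega
  · simp [Test.Holds, State.setReg_reg, State.setMem_mem, hi, h0, h1, h2] at h ⊢
    refine ⟨?_, _, (hs.stored.nextAddr_two i h).2, fun k j => ?_⟩
    · repeat first
        | exact hs
        | refine Layout.Env.setReg ?_ _ (by omega)
        | refine Layout.Env.setMem ?_ _ _ (by omega)
    · split_ifs <;> first | rfl | omega
  · simp [Test.Holds, State.setReg_reg, State.setMem_mem, hi, h0, h1, h2] at h ⊢
    refine ⟨?_, _, hs.stored.nextAddr_one i h, fun k j => ?_⟩
    · repeat first
        | exact hs
        | refine Layout.Env.setReg ?_ _ (by omega)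
        | refine Layout.Env.setMem ?_ _ _ (by omega)
    · split_ifs <;> first | rfl | omega

theorem cells_spec {s : State} (hs : G.Env s) (h4 : s.reg 4 = 0) (hw : 4 * G.M + 4 ≤ 2 ^ w) :
    WP G.cmp w (.while (.lt 4 1) cellBody) (fun t s' => t ≤ 11 * G.M + 1 ∧ G.Env s' ∧
      G.Cells G.M s'.mem ∧ ∀ i < G.M, s'.mem 7 i = 0) s := by
  refine (WP.while (fun n s => G.Env s ∧ ∃ i ≤ G.M, s.reg 4 = i ∧ G.Cells i s.mem ∧
    (∀ j < i, s.mem 7 j = 0) ∧ n = 11 * (G.M - i)) (n := 11 * G.M)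
    ⟨hs, 0, by omega, h4, fun i hi => by omega, fun i hi => by omega, rfl⟩ ?_).mono ?_
  · rintro n s ⟨hs, i, hi, h4, hc, h7, rfl⟩ hlt
    have hlt : i < G.M := by
      have : s.reg 4 < s.reg 1 := hlt
      rwa [h4, hs.stored.numEdges] at this
    refine (cellBody_spec hs ⟨i, hlt⟩ h4 hw).mono ?_
    rintro t s' ⟨ht, hs', h4', a, ha, hm⟩
    simp only at h4' hm
    refine ⟨11 * (G.M - (i + 1)), ⟨hs', i + 1, hlt, h4', fun j hj => ?_, fun j hj => ?_, rfl⟩,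
      by omega⟩
    · rcases Nat.lt_succ_iff_lt_or_eq.1 hj with hj | hj
      · have hne : (j : ℕ) ≠ i := by omega
        simpa [hm, hne] using hc j hj
      · obtain rfl : j = ⟨i, hlt⟩ := Fin.ext hj
        simpa [hm] using ha
    · rcases Nat.lt_succ_iff_lt_or_eq.1 hj with hj | rfl
      · simpa [hm] using fun _ => h7 j hj
      · simp [hm]
  · rintro t s ⟨n, ⟨hs, i, hi, h4, hc, h7, rfl⟩, hlt, ht⟩
    have hlt : ¬ s.reg 4 < s.reg 1 := hlt
    rw [h4, hs.stored.numEdges] at hlt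
    obtain rfl : i = G.M := by omega
    exact ⟨by omega, hs, hc, h7⟩

/-- The rule for `forLong`: the invariant `J i c` carries a time credit `c`. -/
theorem forLong_spec {p : Prog} (B : ℕ) (J : ℕ → ℕ → (ℕ → ℕ → ℕ) → Prop) {c : ℕ} {s : State}
    (hs : G.Env s) (hw : 4 * G.M + 4 ≤ 2 ^ w) (h0 : J 0 c s.mem)
    (hp : ∀ (i : Fin G.M) (c : ℕ) (s : State), G.Env s → s.reg 4 = i → J i c s.mem →
      2 ≤ (G.edge i).1.slen → WP G.cmp w p (fun t s' => G.Env s' ∧ s'.reg 4 = i ∧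
        ∃ c', J (i + 1) c' s'.mem ∧ t + c' ≤ c + B) s)
    (hskip : ∀ (i : Fin G.M) (c : ℕ) (m : ℕ → ℕ → ℕ), J i c m → ¬ 2 ≤ (G.edge i).1.slen →
      J (i + 1) c m) :
    WP G.cmp w (forLong p) (fun t s' => G.Env s' ∧ ∃ c', J G.M c' s'.mem ∧
      t + c' ≤ c + (B + 5) * G.M + 2) s := by
  have hz := hs.zero
  refine .seq <| .copy <| (WP.while (fun n s => G.Env s ∧ ∃ i c, i ≤ G.M ∧ s.reg 4 = i ∧
    J i c s.mem ∧ n = c + (B + 5) * (G.M - i)) (n := c + (B + 5) * G.M)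
    ⟨hs.setReg _ (by omega), 0, c, by omega, by simp [State.setReg_reg, hz], h0, rfl⟩ ?_).mono ?_
  · rintro n s ⟨hs, i, c, hi, h4, hJ, rfl⟩ hlt
    have hlt : i < G.M := by
      have : s.reg 4 < s.reg 1 := hlt
      rwa [h4, hs.stored.numEdges] at this
    obtain ⟨d, hd⟩ : ∃ d, G.M - i = d + 1 := ⟨G.M - i - 1, by omega⟩
    have hd' : G.M - (i + 1) = d := by omega
    have hcost : (B + 5) * (G.M - i) = (B + 5) * d + (B + 5) := by rw [hd]; ring
    have hlen : (s.setReg 5 (s.mem 6 (s.reg 4))).reg 5 = (G.edge ⟨i, hlt⟩).1.slen := by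
      simp [State.setReg_reg, h4, ← hs.stored.slen]
    have hs5 : G.Env (s.setReg 5 (s.mem 6 (s.reg 4))) := hs.setReg _ (by omega)
    refine .seq <| .load <| .seq <| .ite (fun h => .copy <| .add ?_ ?_) fun h => ?_
    · simp [State.setReg_reg, h4, hs.one]
      omega
    · simp only [Test.Holds] at h
      rw [hlen, hs5.two] at h
      refine ⟨c + (B + 5) * d, ⟨(hs5.setReg _ (by omega)).setReg _ (by omega), i + 1, c, hlt, ?_,
        hskip ⟨i, hlt⟩ c _ hJ (by omega), by rw [hd']⟩, by omega⟩
      simp [State.setReg_reg, h4, hs.one]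
    · simp only [Test.Holds] at h
      rw [hlen, hs5.two] at h
      refine (hp ⟨i, hlt⟩ c _ hs5 (by simp [State.setReg_reg, h4]) hJ (by omega)).mono ?_
      rintro t s' ⟨hs', h4', c', hJ', ht⟩
      simp only at h4'
      refine .add ?_ ?_
      · rw [h4', hs'.one]
        omega
      · refine ⟨c' + (B + 5) * d, ⟨hs'.setReg _ (by omega), i + 1, c', hlt, ?_, hJ', by rw [hd']⟩,
          by omega⟩
        simp [State.setReg_reg, h4', hs'.one]
  · rintro t s ⟨n, ⟨hs, i, c', hi, h4, hJ, rfl⟩, hlt, ht⟩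
    have hlt : ¬ s.reg 4 < s.reg 1 := hlt
    rw [h4, hs.stored.numEdges] at hlt
    obtain rfl : i = G.M := by omega
    simp only [Nat.sub_self, mul_zero, add_zero] at ht
    exact ⟨hs, c', hJ, by omega⟩

theorem searchBody_spec {s : State} (hs : G.Env s) (hw : s.reg 7 + s.reg 8 + 1 < 2 ^ w) :
    WP G.cmp w searchBody (fun t s' => t = 5 ∧ G.Env s' ∧ s'.mem = s.mem ∧
      s'.reg 4 = s.reg 4 ∧ s'.reg 9 = s'.reg 7 + 1 ∧
      (G.cmp (s.reg 4) ((s.reg 7 + s.reg 8) / 2) ∧ s'.reg 7 = s.reg 7 ∧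
          s'.reg 8 = (s.reg 7 + s.reg 8) / 2 ∨
        ¬ G.cmp (s.reg 4) ((s.reg 7 + s.reg 8) / 2) ∧ s'.reg 7 = (s.reg 7 + s.reg 8) / 2 ∧
          s'.reg 8 = s.reg 8)) s := by
  have h1 := hs.one
  refine .seq <| .add (by omega) <| .seq <| .half <| .seq <|
    .ite (fun h => .copy <| .add ?_ ?_) (fun h => .copy <| .add ?_ ?_)
  · simp [State.setReg_reg, h1]
    omega
  · simp [Test.Holds, State.setReg_reg, h1] at h ⊢
    refine ⟨?_, .inl h⟩
    repeat first
        | exact hs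
        | refine Layout.Env.setReg ?_ _ (by omega)
  · simp [State.setReg_reg, h1]
    omega
  · simp [Test.Holds, State.setReg_reg, h1] at h ⊢
    refine ⟨?_, .inr h⟩
    repeat first
        | exact hs
        | refine Layout.Env.setReg ?_ _ (by omega)

theorem clog_half_succ {n m : ℕ} (hn : 2 ≤ n) (hm : m ≤ (n + 1) / 2) :
    Nat.clog 2 m + 1 ≤ Nat.clog 2 n := by
  rw [Nat.clog_of_two_le one_lt_two hn]
  exact Nat.succ_le_succ (Nat.clog_mono_right 2 hm)

/-- The target stays in the half-open interval `[l, r)`. Each round costs 6 steps and lowers the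
rounded-up logarithm of its length by at least one, whichever half is kept. -/
theorem search_spec {s : State} (hs : G.Env s) {i k L R : ℕ} (h4 : s.reg 4 = i)
    (h7 : s.reg 7 = L) (h8 : s.reg 8 = R) (h9 : s.reg 9 = L + 1) (hLk : L ≤ k) (hkR : k < R)
    (hR : R ≤ G.M) (hw : 4 * G.M + 4 ≤ 2 ^ w)
    (hcmp : ∀ m, L ≤ m → m < R → (G.cmp i m ↔ k < m)) :
    WP G.cmp w (.while (.lt 9 8) searchBody) (fun t s' => t ≤ 6 * Nat.clog 2 (R - L) + 1 ∧
      G.Env s' ∧ s'.mem = s.mem ∧ s'.reg 4 = i ∧ s'.reg 7 = k ∧ s'.reg 9 = k + 1) s := by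
  refine (WP.while (fun n s' => G.Env s' ∧ s'.mem = s.mem ∧ s'.reg 4 = i ∧ ∃ l r, s'.reg 7 = l ∧
    s'.reg 8 = r ∧ s'.reg 9 = l + 1 ∧ L ≤ l ∧ l ≤ k ∧ k < r ∧ r ≤ R ∧ n = 6 * Nat.clog 2 (r - l))
    ⟨hs, rfl, h4, L, R, h7, h8, h9, le_rfl, hLk, hkR, le_rfl, rfl⟩ ?_).mono ?_
  · rintro n s' ⟨hs', hm, h4, l, r, h7, h8, h9, hl, hlk, hkr, hr, rfl⟩ hlt
    have hlt : l + 1 < r := by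
      have : s'.reg 9 < s'.reg 8 := hlt
      rwa [h9, h8] at this
    refine (searchBody_spec hs' (by omega)).mono ?_
    rintro t s'' ⟨ht, hs'', hm', h4', h9', hc⟩
    rw [h4, h7, h8, hcmp _ (by omega) (by omega)] at hc
    rcases hc with ⟨hc, h7', h8'⟩ | ⟨hc, h7', h8'⟩
    · have := clog_half_succ (n := r - l) (m := (l + r) / 2 - l) (by omega) (by omega)
      exact ⟨_, ⟨hs'', hm'.trans hm, h4'.trans h4, l, (l + r) / 2, h7', h8', by rw [h9', h7'],
        hl, hlk, hc, by omega, rfl⟩, by omega⟩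
    · have := clog_half_succ (n := r - l) (m := r - (l + r) / 2) (by omega) (by omega)
      exact ⟨_, ⟨hs'', hm'.trans hm, h4'.trans h4, (l + r) / 2, r, h7', h8', by rw [h9', h7'],
        by omega, by omega, hkr, hr, rfl⟩, by omega⟩
  · rintro t s' ⟨n, ⟨hs', hm, h4, l, r, h7, h8, h9, hl, hlk, hkr, hr, rfl⟩, hlt, ht⟩
    have hlt : ¬ l + 1 < r := by
      have : ¬ s'.reg 9 < s'.reg 8 := hlt
      rwa [h9, h8] at this
    obtain rfl : l = k := by omega
    exact ⟨by omega, hs', hm, h4, h7, h9⟩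

/-- Whether the edge suffix link is a single edge is visible at its first cell: the chain has ended
precisely when the lower end has type 1, that is, when the successor address is 0. -/
theorem linked_of_isESuf {m : ℕ → ℕ → ℕ} (hc : G.Cells G.M m) {i k : Fin G.M}
    (hi : 2 ≤ (G.edge i).1.slen) {p : List (Edge α)}
    (hs : IsESuf T (G.edge i).1 ((G.edge k).1 :: p)) (hp : TypeChain T ((G.edge k).1 :: p))
    (h10 : m 10 i = k) (h7 : m 7 i = if m 9 (k + 1) = 0 then 0 else (k : ℕ) + 1) :
    G.Linked m i := by
  have h9 := (hc k k.2).2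
  cases hp with
  | single he h1 =>
    rcases h9 with ⟨-, h9⟩ | ⟨h2, -⟩
    · rw [if_pos h9] at h7
      exact .inr ⟨h7, k, h10, hs⟩
    · exact absurd h1.off_eq h2.off_ne
  | cons he h2 hhi hp =>
    rcases h9 with ⟨h1, -⟩ | ⟨-, l, -, h9⟩
    · exact absurd h1.off_eq h2.off_ne
    · rw [if_neg (by omega)] at h7
      exact .inl ⟨by omega, k, h7, _, .path (G.edge i).2 hi hs (by simp), .cons he h2 hhi hp⟩

theorem linkEdge_spec [Fintype α] {s : State} (hs : G.Env s) (i : Fin G.M) (h4 : s.reg 4 = i)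
    (hw : 4 * G.M + 4 ≤ 2 ^ w) (hlen : 2 ≤ (G.edge i).1.slen) (hc : G.Cells G.M s.mem)
    (h7 : s.mem 7 i = 0) :
    WP G.cmp w linkEdge (fun t s' => t ≤ 6 * Nat.clog 2 (Fintype.card α) + 10 ∧ G.Env s' ∧
      s'.reg 4 = i ∧ G.Linked s'.mem i ∧
      ∀ l j : ℕ, (l ≠ 7 ∧ l ≠ 10 ∨ j ≠ i) → s'.mem l j = s.mem l j) s := by
  obtain ⟨e, p, hp, hch⟩ := (G.edge i).2.exists_esuf hlen
  obtain ⟨he, hsl, hlab⟩ := hp.spec_head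
  obtain ⟨k, rfl⟩ := G.exists_edge he
  obtain ⟨v, hv, hvm⟩ := hs.stored.exists_hi i
  obtain ⟨v', hv', -⟩ := hs.stored.exists_hi k
  have hslm : s.mem 1 v = v' := hs.stored.slink v v' (by rwa [hv, hv'])
  obtain ⟨hLk, hkR⟩ := (hs.stored.out v' k).2 ⟨k.2, hv'.symm⟩
  have hRM : s.mem 3 v' ≤ G.M := by
    obtain ⟨h, -⟩ := (hs.stored.out v' (s.mem 3 v' - 1)).1 ⟨by omega, by omega⟩
    omega
  have hdeg := Nat.clog_mono_right 2 (hs.stored.degree_le v')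
  -- Edges `i` and `k` start with the same letter, so comparing `i` with `m` amounts to comparing
  -- `k` with `m`, which the sorted numbering decides.
  have hcmp : ∀ m, s.mem 2 v' ≤ m → m < s.mem 3 v' → (G.cmp i m ↔ (k : ℕ) < m) := by
    intro m hm hm'
    obtain ⟨hmM, hmhi⟩ := (hs.stored.out v' m).1 ⟨hm, hm'⟩
    obtain ⟨c, r, hcr⟩ := (G.edge k).2.exists_lab_eq
    obtain ⟨q, hq⟩ := hlab
    have hcr' : (G.edge i).1.lab = c :: (r ++ q) := by rw [← hq, hcr, List.cons_append]
    have hiff := G.firstCharLT_iff (i := k) (j := ⟨m, hmM⟩) (by rw [hmhi, hv'])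
    rw [firstCharLT_congr hcr hcr'] at hiff
    exact ⟨fun ⟨_, _, h⟩ => hiff.1 h, fun h => ⟨i.2, hmM, hiff.2 h⟩⟩
  have h2 := hs.one
  refine .seq <| .load <| .seq <| .load <| .seq <| .load <| .seq <| .load <| .seq <| .add ?_ <|
    .seq ?_
  · simp [State.setReg_reg, h4, hvm, hslm, h2]
    omega
  refine (search_spec (i := i) (k := k) (L := s.mem 2 v') (R := s.mem 3 v') ?_ ?_ ?_ ?_ ?_ hLk hkR
    hRM hw hcmp).mono ?_
  · repeat first
        | exact hs
        | refine Layout.Env.setReg ?_ _ (by omega)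
  · simp [State.setReg_reg, h4]
  · simp [State.setReg_reg, h4, hvm, hslm]
  · simp [State.setReg_reg, h4, hvm, hslm]
  · simp [State.setReg_reg, h4, hvm, hslm, h2]
  rintro t s' ⟨ht, hs', hm, h4', h7', h9'⟩
  simp only [State.setReg_mem] at hm
  refine .seq <| .store <| .seq <| .load <| .ite (fun h => .copy ?_) (fun h => .store ?_)
  · simp [Test.Holds, State.setReg_reg, State.setMem_mem, h9', hs'.zero, hm] at h
    refine ⟨by omega, ?_, by simp [State.setReg_reg, h4'],
      linked_of_isESuf (k := k) (fun j hj => ?_) hlen hp hch ?_ ?_, ?_⟩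
    · repeat first
        | exact hs'
        | refine Layout.Env.setReg ?_ _ (by omega)
        | refine Layout.Env.setMem ?_ _ _ (by omega)
    · simpa [State.setMem_mem, hm] using hc j hj
    · simp [State.setMem_mem, h4', h7']
    · simp [State.setMem_mem, h, h7, hm]
    · intro l j hlj
      simp only [State.setReg_mem, State.setMem_mem, h4', hm]
      rw [if_neg (by omega)]
  · simp [Test.Holds, State.setReg_reg, State.setMem_mem, h9', hs'.zero, hm] at h
    refine ⟨by omega, ?_, by simp [State.setReg_reg, h4'],
      linked_of_isESuf (k := k) (fun j hj => ?_) hlen hp hch ?_ ?_, ?_⟩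
    · repeat first
        | exact hs'
        | refine Layout.Env.setReg ?_ _ (by omega)
        | refine Layout.Env.setMem ?_ _ _ (by omega)
    · simpa [State.setMem_mem, State.setReg_reg, hm] using hc j hj
    · simp [State.setMem_mem, State.setReg_reg, h4', h7']
    · simp [State.setMem_mem, State.setReg_reg, h, h4', h9', hm]
    · intro l j hlj
      simp only [State.setReg_mem, State.setReg_reg, State.setMem_reg, State.setMem_mem, h4', hm,
        Nat.reduceEqDiff, reduceIte]
      rw [if_neg (by omega), if_neg (by omega)]

/-- The number of zeros among the first `n` values. -/
def numZeros (n : ℕ) (f : ℕ → ℕ) : ℕ := ((Finset.range n).filter fun j => f j = 0).card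

theorem numZeros_le (n : ℕ) (f : ℕ → ℕ) : numZeros n f ≤ n := by
  simpa [numZeros] using Finset.card_filter_le (Finset.range n) fun j => f j = 0

theorem numZeros_update {n j a : ℕ} {f : ℕ → ℕ} (hj : j < n) (h0 : f j = 0) (ha : a ≠ 0) :
    numZeros n (Function.update f j a) + 1 = numZeros n f := by
  have : ((Finset.range n).filter fun k => Function.update f j a k = 0) =
      ((Finset.range n).filter fun k => f k = 0).erase j := by
    ext k
    by_cases hk : k = j
    · simp [hk, ha]
    · simp [hk]
  rw [numZeros, this, Finset.card_erase_add_one (by simp [hj, h0]), numZeros]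

theorem linked_update {m : ℕ → ℕ → ℕ} {a : ℕ} {i j : Fin G.M} (hi : G.Linked m i)
    (ha : G.JumpAddr j a) : G.Linked (Function.update m 7 (Function.update (m 7) j a)) i := by
  by_cases hij : i = j
  · subst hij
    exact .inl (by simpa using ⟨ha.ne_zero, ha⟩)
  · have : (i : ℕ) ≠ j := fun h => hij (Fin.ext h)
    simpa [Layout.Linked, this] using hi

/-- Amortised cost: an unresolved edge that is passed costs 3 steps in the search and 4 in the
copying, and is resolved for good. So 7 credits per zero entry pay for both loops. -/
theorem resolveEdge_spec {s : State} (hs : G.Env s) (i : Fin G.M) (h4 : s.reg 4 = i)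
    (hlen : 2 ≤ (G.edge i).1.slen)
    (hlink : ∀ j : Fin G.M, 2 ≤ (G.edge j).1.slen → G.Linked s.mem j) :
    WP G.cmp w resolveEdge (fun t s' => t + 7 * numZeros G.M (s'.mem 7) ≤
        7 * numZeros G.M (s.mem 7) + 6 ∧ G.Env s' ∧ s'.reg 4 = i ∧ s'.mem 7 i ≠ 0 ∧
      (∀ j : Fin G.M, 2 ≤ (G.edge j).1.slen → G.Linked s'.mem j) ∧
      (∀ j, s.mem 7 j ≠ 0 → s'.mem 7 j ≠ 0) ∧ ∀ l, l ≠ 7 → s'.mem l = s.mem l) s := by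
  obtain ⟨D, a, hr⟩ := Layout.exists_reach hlink i hlen
  refine .seq <| .copy <| .seq <| .load <| .seq <| (WP.while (fun n s' => G.Env s' ∧
    s'.mem = s.mem ∧ s'.reg 4 = i ∧ ∃ (j : Fin G.M) (d : ℕ), s'.reg 6 = j ∧
      2 ≤ (G.edge j).1.slen ∧ s'.reg 7 = s.mem 7 j ∧ Reach (s.mem 7) (s.mem 10) j d a ∧ n = 3 * d)
    ⟨(hs.setReg _ (by omega)).setReg _ (by omega), rfl, by simp [State.setReg_reg, h4], i, D,
      by simp [State.setReg_reg, h4], hlen, by simp [State.setReg_reg, h4], hr, rfl⟩ ?_).mono ?_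
  · rintro n s' ⟨hs', hm, h4', j, d, h6, hj, h7, hr, rfl⟩ h
    have h : s.mem 7 j = 0 := by
      have : s'.reg 7 = s'.reg 11 := h
      rwa [h7, hs'.zero] at this
    obtain ⟨-, k, hk, hsuf⟩ := (hlink j hj).resolve_left fun h' => h'.1 h
    cases hr with
    | zero h' => exact absurd h h'
    | @succ _ d _ _ hr =>
      rw [hk] at hr
      refine .seq <| .load <| .load ⟨3 * d, ⟨(hs'.setReg _ (by omega)).setReg _ (by omega), hm,
        by simp [State.setReg_reg, h4'], k, d, by simp [State.setReg_reg, h6, hm, hk],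
        by rwa [Edge.slen, hsuf.slen_single], by simp [State.setReg_reg, h6, hm, hk], hr, rfl⟩,
        by omega⟩
  rintro t s₁ ⟨n, ⟨hs₁, hm, h4₁, j, d, -, hj, h7, hr', rfl⟩, hne, ht⟩
  have h7 : s₁.reg 7 = a := by
    have : s₁.reg 7 ≠ s₁.reg 11 := hne
    rw [h7, hs₁.zero] at this
    cases hr' with
    | zero => exact h7
    | succ h => exact absurd h this
  refine .seq <| .copy <| .seq <| .load <| (WP.while (fun n s' => G.Env s' ∧ s'.reg 4 = i ∧
    s'.reg 7 = a ∧ ∃ (j : Fin G.M) (d : ℕ), s'.reg 6 = j ∧ 2 ≤ (G.edge j).1.slen ∧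
      s'.reg 8 = s'.mem 7 j ∧ Reach (s'.mem 7) (s'.mem 10) j d a ∧ (j = i ∨ s'.mem 7 i ≠ 0) ∧
      (∀ j : Fin G.M, 2 ≤ (G.edge j).1.slen → G.Linked s'.mem j) ∧
      (∀ j, s.mem 7 j ≠ 0 → s'.mem 7 j ≠ 0) ∧ (∀ l, l ≠ 7 → s'.mem l = s.mem l) ∧
      numZeros G.M (s'.mem 7) + D = numZeros G.M (s.mem 7) + d ∧ n = 4 * d) (n := 4 * D)
    ⟨(hs₁.setReg _ (by omega)).setReg _ (by omega), by simp [State.setReg_reg, h4₁],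
      by simp [State.setReg_reg, h7], i, D, by simp [State.setReg_reg, h4₁], hlen,
      by simp [State.setReg_reg, h4₁], by simpa [hm] using hr, .inl rfl, by simpa [hm] using hlink,
      by simp [hm], by simp [hm], by simp [hm], rfl⟩ ?_).mono ?_
  · rintro n s' ⟨hs', h4', h7', j, d, h6, hj, h8, hr, hor, hl, hmono, hmem, hz, rfl⟩ h
    have h : s'.mem 7 j = 0 := by
      have : s'.reg 8 = s'.reg 11 := h
      rwa [h8, hs'.zero] at this
    obtain ⟨-, k, hk, hsuf⟩ := (hl j hj).resolve_left fun h' => h'.1 h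
    have ha := hr.jumpAddr hl j rfl hj
    have hzu := numZeros_update j.2 h ha.ne_zero
    have hr0 := hr
    cases hr with
    | zero h' => exact absurd h h'
    | @succ _ d _ _ hr =>
      rw [hk] at hr
      have hmem7 : (s'.setMem 7 j a).mem = Function.update s'.mem 7
        (Function.update (s'.mem 7) j a) := rfl
      have hmono7 : ∀ l, s'.mem 7 l ≠ 0 → Function.update (s'.mem 7) j a l ≠ 0 := fun l hl => by
        by_cases hlj : l = j
        · simpa [hlj] using ha.ne_zero
        · simpa [hlj] using hl
      refine .seq <| .store <| .seq <| .load <| .load ⟨4 * d, ⟨?_, ?_, ?_, k, d, ?_, ?_, ?_, ?_,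
        .inr ?_, ?_, ?_, ?_, ?_, rfl⟩, by omega⟩
      · exact ((hs'.setMem _ _ (by omega)).setReg _ (by omega)).setReg _ (by omega)
      · simp [State.setReg_reg, h4']
      · simp [State.setReg_reg, h7']
      · simp [State.setReg_reg, State.setMem_mem, h6, hk]
      · rwa [Edge.slen, hsuf.slen_single]
      · simp [State.setReg_reg, State.setMem_mem, h6, hk]
      · simpa [h6, h7', hmem7] using hr.update a hr0 (by omega)
      · simp only [State.setReg_mem, h6, h7', hmem7, Function.update_self]
        rcases hor with rfl | hor
        · simpa using ha.ne_zero
        · exact hmono7 i hor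
      · intro l hl'
        simp only [State.setReg_mem, h6, h7', hmem7]
        exact linked_update (hl l hl') ha
      · intro l hl'
        simp only [State.setReg_mem, h6, h7', hmem7, Function.update_self]
        exact hmono7 l (hmono l hl')
      · intro l hl'
        simp only [State.setReg_mem, h6, h7', hmem7, Function.update_of_ne hl']
        exact hmem l hl'
      · simp only [State.setReg_mem, h6, h7', hmem7, Function.update_self]
        omega
  · rintro t' s' ⟨n, ⟨hs', h4', h7', j, d, h6, hj, h8, hr', hor, hl, hmono, hmem, hz, rfl⟩, hne, ht'⟩
    have hne : s'.mem 7 j ≠ 0 := by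
      have : s'.reg 8 ≠ s'.reg 11 := hne
      rwa [h8, hs'.zero] at this
    have hd : d = 0 := (hr'.unique (.zero hne)).1
    refine ⟨by omega, hs', h4', ?_, hl, hmono, hmem⟩
    rcases hor with rfl | h
    · exact hne
    · exact h

theorem program_spec [Fintype α] {s : State} (hs : G.Stored s) (hw : 4 * G.M + 4 ≤ 2 ^ w) :
    WP G.cmp w program (fun t s' => t ≤ (6 * Nat.clog 2 (Fintype.card α) + 50) * (G.M + 1) ∧
      G.Stored s' ∧ G.JumpsStored s') s := by
  have h2w : 4 ≤ 2 ^ w := by omega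
  refine .seq <| .const (by omega) <| .seq <| .const (by omega) <| .seq <| .const (by omega) <|
    .seq <| .copy <| .seq ?_
  refine (cells_spec ((⟨hs.of_eq ?_ ?_ fun _ _ => rfl, ?_, ?_, ?_⟩ : G.Env
    (((s.setReg 2 1).setReg 3 2).setReg 11 0)).setReg _ (by omega)) ?_ hw).mono ?_
  any_goals simp [State.setReg_reg]
  intro t₁ s₁ ht₁ hs₁ hc₁ hz₁
  refine .seq ?_
  refine (forLong_spec (6 * Nat.clog 2 (Fintype.card α) + 10) (fun n c m => c = 0 ∧
    G.Cells G.M m ∧ (∀ j : Fin G.M, (j : ℕ) < n → 2 ≤ (G.edge j).1.slen → G.Linked m j) ∧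
    ∀ j : Fin G.M, n ≤ (j : ℕ) → m 7 j = 0) (c := 0) hs₁ hw
    ⟨rfl, hc₁, fun j hj => by omega, fun j _ => hz₁ j j.2⟩ ?_ ?_).mono ?_
  · rintro i c s hs h4 ⟨rfl, hc, hl, hz⟩ hi
    refine (linkEdge_spec hs i h4 hw hi hc (hz i le_rfl)).mono ?_
    rintro t s' ⟨ht, hs', h4', hli, hm⟩
    refine ⟨hs', h4', 0, ⟨rfl, fun j hj => ?_, fun j hj hjl => ?_, fun j hj => ?_⟩, by omega⟩
    · rw [hm 8 _ (by omega), hm 9 _ (by omega)]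
      exact hc j hj
    · rcases Nat.lt_succ_iff_lt_or_eq.1 hj with hj | hj
      · have := hl j hj hjl
        rwa [Layout.Linked, ← hm 7 j (by omega), ← hm 10 j (by omega)] at this
      · rwa [Fin.ext hj]
    · rw [hm 7 j (by omega)]
      exact hz j (by omega)
  · rintro i c m ⟨rfl, hc, hl, hz⟩ hi
    refine ⟨rfl, hc, fun j hj hjl => ?_, fun j hj => hz j (by omega)⟩
    rcases Nat.lt_succ_iff_lt_or_eq.1 hj with hj | hj
    · exact hl j hj hjl
    · exact absurd (Fin.ext hj ▸ hjl) hi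
  rintro t₂ s₂ ⟨hs₂, c₂, ⟨rfl, hc₂, hl₂, -⟩, ht₂⟩
  refine (forLong_spec 6 (fun n c m => c = 7 * numZeros G.M (m 7) ∧ G.Cells G.M m ∧
    (∀ j : Fin G.M, 2 ≤ (G.edge j).1.slen → G.Linked m j) ∧
    ∀ j : Fin G.M, (j : ℕ) < n → 2 ≤ (G.edge j).1.slen → m 7 j ≠ 0) hs₂ hw
    ⟨rfl, hc₂, fun j => hl₂ j j.2, fun j hj => by omega⟩ ?_ ?_).mono ?_
  · rintro i c s hs h4 ⟨rfl, hc, hl, hz⟩ hi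
    refine (resolveEdge_spec hs i h4 hi hl).mono ?_
    rintro t s' ⟨ht, hs', h4', hi7, hl', hmono, hm⟩
    refine ⟨hs', h4', _, ⟨rfl, fun j hj => ?_, hl', fun j hj hjl => ?_⟩, by omega⟩
    · rw [hm 8 (by omega), hm 9 (by omega)]
      exact hc j hj
    · rcases Nat.lt_succ_iff_lt_or_eq.1 hj with hj | hj
      · exact hmono _ (hz j hj hjl)
      · rwa [Fin.ext hj]
  · rintro i c m ⟨rfl, hc, hl, hz⟩ hi
    refine ⟨rfl, hc, hl, fun j hj hjl => ?_⟩
    rcases Nat.lt_succ_iff_lt_or_eq.1 hj with hj | hj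
    · exact hz j hj hjl
    · exact absurd (Fin.ext hj ▸ hjl) hi
  rintro t₃ s₃ ⟨hs₃, c₃, ⟨rfl, hc₃, hl₃, hz₃⟩, ht₃⟩
  have hn := numZeros_le G.M (s₂.mem 7)
  refine ⟨?_, hs₃.stored, hc₃.jumpsStored fun i hi =>
    ((hl₃ i hi).resolve_right fun h => hz₃ i i.2 hi h.1).2⟩
  set q := 6 * Nat.clog 2 (Fintype.card α)
  -- Up to additive constants, writing cells costs `11 M`, linking `(q + 15) M`, and resolving `11
  -- M` plus at most `7 M` of credit.
  have e1 : (q + 10 + 5) * G.M = q * G.M + 15 * G.M := by ring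
  have e2 : (q + 50) * (G.M + 1) = q * G.M + q + 50 * G.M + 50 := by ring
  omega

end Jump

end Layout

/-! ### Bounds in terms of the extensions and the alphabet size -/

theorem Layout.M_le {α : Type u} [LT α] {T : List α} (G : Layout T) : G.M ≤ numExtensions T := by
  rw [← Nat.card_fin G.M, Nat.card_congr G.edge]
  exact (card_edges_le T).2

theorem Layout.M_pos {α : Type u} [LT α] {T : List α} (G : Layout T) (hT : T ≠ []) : 0 < G.M := by
  obtain ⟨e, he⟩ := exists_edge_of_ne_nil hT
  exact (G.edge.symm ⟨e, he⟩).pos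

/-- Rounding up adds less than 1, which is at most the logarithm itself. -/
theorem clog_le_two_mul_logb {n : ℕ} (hn : 2 ≤ n) : (Nat.clog 2 n : ℝ) ≤ 2 * Real.logb 2 n := by
  have h1 : (1 : ℝ) ≤ Real.logb 2 n := by
    rw [Real.le_logb_iff_rpow_le one_lt_two (by positivity)]
    simpa using (by exact_mod_cast hn : (2 : ℝ) ≤ n)
  have := Nat.ceil_lt_add_one (zero_le_one.trans h1)
  have h := Real.natCeil_logb_natCast 2 n
  rw [Nat.cast_ofNat] at h
  rw [h] at this
  linarith

end LCDAWG

theorem mainTheorem4 :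
    (∀ (α : Type u) [Fintype α] [LinearOrder α] (T : List α),
      2 ≤ Fintype.card α → EndsWithUniqueChar T →
      ∀ e : Edge α, IsEdge T e → 2 ≤ e.slen →
        ∃ p : List (Edge α), IsJump T e p ∧ (∀ q, IsJump T e q → q = p) ∧
          (∃ v w, IsPath T v p w) ∧ 2 ≤ p.length ∧ pathLab p = e.lab) ∧
    ∃ (prog : Prog) (C : ℕ),
      ∀ (α : Type u) [Fintype α] [LinearOrder α] (T : List α),
        2 ≤ Fintype.card α → EndsWithUniqueChar T →
        ∀ (G : Layout T) (w : ℕ), C * (T.length + numExtensions T) ≤ 2 ^ w →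
        ∀ s : State, s.IsWordState w → G.Stored s →
          ∃ (t : ℕ) (s' : State), Exec G.cmp w prog s t s' ∧
            (t : ℝ) ≤ C * (numExtensions T : ℝ) * Real.logb 2 (Fintype.card α) ∧
            G.Stored s' ∧ G.JumpsStored s' := by
  -- `224 = 56 * 2 * 2`: with `q` the rounded-up logarithm, `6 q + 50 ≤ 56 q` as `q ≥ 1`, then `M +
  -- 1 ≤ 2 ẽ_T` as `1 ≤ M ≤ ẽ_T`, and `q ≤ 2 log σ`. The word size bound `4 M + 4 ≤ 2 ^ w` follows
  -- too.
  refine ⟨fun α _ _ T _ _ e he hlen => ?_, Jump.program, 224,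
    fun α _ _ T hσ hT G w hw s hs hG => ?_⟩
  · obtain ⟨p, hp, hpath, hlen, hlab⟩ := he.exists_jump hlen
    exact ⟨p, hp, fun q hq => hq.unique hp, hpath, hlen, hlab⟩
  · have hne : T ≠ [] := by
      obtain ⟨S, d, rfl, -⟩ := hT
      simp
    have hpos := G.M_pos hne
    have hle := G.M_le
    have hlen := List.length_pos_iff.2 hne
    obtain ⟨t, s', hexec, -, ht, hG', hJ⟩ := Jump.program_spec (w := w) hG (by omega) hs
    refine ⟨t, s', hexec, ?_, hG', hJ⟩
    set q := Nat.clog 2 (Fintype.card α)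
    have hq := clog_le_two_mul_logb hσ
    have hq1 : 1 ≤ q := Nat.clog_pos one_lt_two hσ
    have ht' : t ≤ 56 * q * (2 * numExtensions T) :=
      ht.trans (Nat.mul_le_mul (by omega) (by omega))
    have ht'' : (t : ℝ) ≤ 56 * q * (2 * numExtensions T) := by exact_mod_cast ht'
    calc (t : ℝ) ≤ 56 * q * (2 * numExtensions T) := ht''
      _ ≤ 56 * (2 * Real.logb 2 (Fintype.card α)) * (2 * numExtensions T) := by gcongr
      _ = _ := by push_cast; ring
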